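/- Let $(\Omega,\mathcal E,\mathbb P)$ be a probability space and $\mathcal F\subset\mathcal E$ a sub-$\sigma$-algebra. Let $L^0(\mathcal E)$ and $L^0(\mathcal F)$ be the spaces of real-valued $\mathcal E$- resp. $\mathcal F$-measurable random variables modulo almost sure equality, ordered by the almost sure order. For $x\in L^0(\mathcal E)$ let $\mathbb E[x|\mathcal F]=\mathbb E[x^+|\mathcal F]-\mathbb E[x^-|\mathcal F]$ be the extended conditional expectation, with values in $[-\infty,\infty]$, defined when at least one of the two terms is almost surely finite. For $1\le p<\infty$ put $$L^p_{\mathcal F}(\mathcal E)=\{x\in L^0(\mathcal E):\ \mathbb E[|x|^p\,|\mathcal F]<\infty \text{ a.s.}\},$$ and $L^\infty_{\mathcal F}(\mathcal E)=\{x\in L^0(\mathcal E):\ |x|\le\eta\text{ for some }\eta\in L^0(\mathcal F)\}$. Let $1\le p<\infty$, let $q$ be the Hölder conjugate of $p$ ($q=\infty$ if $p=1$), and let $\rho:L^p_{\mathcal F}(\mathcal E)\to L^0(\mathcal F)$ be a conditional risk measure, that is, for all $x,y\in L^p_{\mathcal F}(\mathcal E)$: (i) $\rho(\eta x+(1-\eta)y)\le\eta\rho(x)+(1-\eta)\rho(y)$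 for all $\eta\in L^0(\mathcal F)$ with $0\le\eta\le1$; (ii) $x\le y$ implies $\rho(y)\le\rho(x)$; (iii) $\rho(x+\eta)=\rho(x)-\eta$ for all $\eta\in L^0(\mathcal F)$. For $y$ in the Köthe dual $\{y\in L^0(\mathcal E): xy\in L^1_{\mathcal F}(\mathcal E)\text{ for all }x\in L^p_{\mathcal F}(\mathcal E)\}$ put $$\rho^\#(y)=\operatorname{ess\,sup}\{\mathbb E[xy|\mathcal F]-\rho(x):\ x\in L^p_{\mathcal F}(\mathcal E)\}.$$ Then: (1) $\rho$ has the Lebesgue property: if $x,y,x_1,x_2,\ldots\in L^p_{\mathcal F}(\mathcal E)$, $|x_n|\le y$ for all $n$ and $x_n\to x$ a.s., then $\rho(x_n)\to\rho(x)$ a.s. (2) For every $x\in L^p_{\mathcal F}(\mathcal E)$ there is $y\in L^q_{\mathcal F}(\mathcal E)$, belonging to the Köthe dual, with $y\le0$ and $\mathbb E[y|\mathcal F]=-1$ such that $$\rho(x)=\mathbb E[xy|\mathcal F]-\rho^\#(y).$$ -/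

import Mathlib

open MeasureTheory Filter Topology
open scoped ENNReal

noncomputable section

namespace CondRisk

/-- The essential supremum of a family of (classes of) extended real random variables exists. -/
theorem exists_isLUB {Ω : Type*} {m0 : MeasurableSpace Ω} (P : Measure Ω) [IsFiniteMeasure P]
    (S : Set (Ω →ₘ[P] EReal)) : ∃ g : Ω →ₘ[P] EReal, IsLUB S g := by
  rcases S.eq_empty_or_nonempty with rfl | ⟨f0, hf0⟩
  · refine ⟨AEEqFun.const Ω ⊥, by simp, fun h _ => ?_⟩
    rw [← AEEqFun.coeFn_le]
    filter_upwards [AEEqFun.coeFn_const Ω (⊥ : EReal) (μ := P)] with ω hω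
    rw [hω]; exact bot_le
  let t : EReal → ℝ≥0∞ := fun a => (1 + EReal.exp (-a))⁻¹
  have ht : StrictMono t := by
    intro a b hab
    refine ENNReal.inv_lt_inv.2 ?_
    exact (ENNReal.add_lt_add_iff_left ENNReal.one_ne_top).2
      (EReal.exp_strictMono (EReal.neg_lt_neg_iff.2 hab))
  have htm : Measurable t := ht.monotone.measurable
  have ht1 : ∀ a, t a ≤ 1 := fun a => ENNReal.inv_le_one.2 le_self_add
  have hm : ∀ c : ℕ → S, Measurable fun ω => ⨆ n, (c n : Ω →ₘ[P] EReal) ω :=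
    fun c => Measurable.iSup fun n => (c n : Ω →ₘ[P] EReal).measurable
  let I : (ℕ → S) → ℝ≥0∞ := fun c => ∫⁻ ω, t (⨆ n, (c n : Ω →ₘ[P] EReal) ω) ∂P
  have hI : ∀ c, I c ≠ ∞ := fun c => by
    refine ne_of_lt (lt_of_le_of_lt (lintegral_mono (g := fun _ => 1) fun ω => ht1 _) ?_)
    simp
  have : Nonempty (ℕ → S) := ⟨fun _ => ⟨f0, hf0⟩⟩
  obtain ⟨u, -, hu, hus⟩ := exists_seq_tendsto_sSup (S := Set.range I)
    (Set.range_nonempty I) (OrderTop.bddAbove _)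
  choose c hc using hus
  let d : ℕ → S := fun n => c n.unpair.1 n.unpair.2
  have hcd : ∀ k ω, (⨆ n, (c k n : Ω →ₘ[P] EReal) ω) ≤ ⨆ n, (d n : Ω →ₘ[P] EReal) ω := by
    intro k ω
    refine iSup_le fun n => ?_
    have := le_iSup (fun n => (d n : Ω →ₘ[P] EReal) ω) (Nat.pair k n)
    simpa [d] using this
  have hdM : sSup (Set.range I) ≤ I d := by
    refine le_of_tendsto' hu fun k => ?_
    rw [← hc k]
    exact lintegral_mono fun ω => ht.monotone (hcd k ω)
  refine ⟨AEEqFun.mk _ (hm d).aestronglyMeasurable, fun f hf => ?_, fun h hh => ?_⟩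
  · obtain ⟨e, he0, he⟩ : ∃ e : ℕ → S, e 0 = ⟨f, hf⟩ ∧ ∀ n, e (n + 1) = d n :=
      ⟨fun n => Nat.rec ⟨f, hf⟩ (fun k _ => d k) n, rfl, fun _ => rfl⟩
    have hde : ∀ ω, (⨆ n, (d n : Ω →ₘ[P] EReal) ω) ≤ ⨆ n, (e n : Ω →ₘ[P] EReal) ω := fun ω =>
      by
      refine iSup_le fun n => ?_
      have := le_iSup (fun n => (e n : Ω →ₘ[P] EReal) ω) (n + 1)
      rwa [he n] at this
    have hae := ae_eq_of_ae_le_of_lintegral_le (μ := P)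
      (Eventually.of_forall fun ω => ht.monotone (hde ω)) (hI d)
      (htm.comp (hm e)).aemeasurable ((le_sSup (Set.mem_range_self e)).trans hdM)
    rw [← AEEqFun.coeFn_le]
    filter_upwards [hae, AEEqFun.coeFn_mk _ (hm d).aestronglyMeasurable] with ω h1 h2
    rw [h2, ht.injective h1]
    have := le_iSup (fun n => (e n : Ω →ₘ[P] EReal) ω) 0
    rwa [he0] at this
  · rw [← AEEqFun.coeFn_le]
    have : ∀ᵐ ω ∂P, ∀ n, (d n : Ω →ₘ[P] EReal) ω ≤ h ω :=
      ae_all_iff.2 fun n => AEEqFun.coeFn_le.2 (hh (d n).2)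
    filter_upwards [this, AEEqFun.coeFn_mk _ (hm d).aestronglyMeasurable] with ω h1 h2
    rw [h2]
    exact iSup_le h1

/-- The essential supremum of a family of extended real random variables: its least upper bound
for the almost sure order. -/
def esssup {Ω : Type*} {m0 : MeasurableSpace Ω} (P : Measure Ω) [IsFiniteMeasure P]
    (S : Set (Ω →ₘ[P] EReal)) : Ω →ₘ[P] EReal :=
  Classical.choose (exists_isLUB P S)

theorem isLUB_esssup {Ω : Type*} {m0 : MeasurableSpace Ω} (P : Measure Ω) [IsFiniteMeasure P]
    (S : Set (Ω →ₘ[P] EReal)) : IsLUB S (esssup P S) :=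
  Classical.choose_spec (exists_isLUB P S)

/-- `L⁰(𝓕)` inside `L⁰(𝓔) = (Ω →ₘ[P] ℝ)`: the classes that have an `𝓕`-measurable representative.
Here and below `m` is the sub-σ-algebra `𝓕` and `m0` is `𝓔`. -/
def L0 {Ω : Type*} (m : MeasurableSpace Ω) {m0 : MeasurableSpace Ω} (P : Measure Ω) :
    Set (Ω →ₘ[P] ℝ) :=
  {x | AEStronglyMeasurable[m] x P}

/-- The extended conditional expectation `E[x | 𝓕] = E[x⁺ | 𝓕] - E[x⁻ | 𝓕]`, meaningful when at
least one of the two terms is finite. -/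
def extCondExp {Ω : Type*} (m : MeasurableSpace Ω) {m0 : MeasurableSpace Ω} (P : Measure Ω)
    (x : Ω →ₘ[P] ℝ) : Ω → EReal := fun ω =>
  (condLExp m P (fun ω' => ENNReal.ofReal (x ω')) ω : EReal)
    - (condLExp m P (fun ω' => ENNReal.ofReal (-x ω')) ω : EReal)

/-- The module `L^p_𝓕(𝓔)`, for `1 ≤ p ≤ ∞`: for `p < ∞` the `x` with `E[|x|^p | 𝓕] < ∞`
almost surely, for `p = ∞` the `x` that are dominated by an element of `L⁰(𝓕)`. -/
def LpF {Ω : Type*} (m : MeasurableSpace Ω) {m0 : MeasurableSpace Ω} (P : Measure Ω) (p : ℝ≥0∞) :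
    Set (Ω →ₘ[P] ℝ) :=
  {x | (p = ∞ → ∃ η ∈ L0 m P, |x| ≤ η) ∧
    (p ≠ ∞ → ∀ᵐ ω ∂P, condLExp m P (fun ω' => ‖x ω'‖ₑ ^ p.toReal) ω < ∞)}

/-- `ρ`, restricted to the `L⁰(𝓕)`-module `X`, is a conditional risk measure `X → L⁰(𝓕)`.
The values of `ρ` outside `X` are irrelevant. -/
structure IsConditionalRiskMeasure {Ω : Type*} (m : MeasurableSpace Ω) {m0 : MeasurableSpace Ω}
    (P : Measure Ω) (X : Set (Ω →ₘ[P] ℝ)) (ρ : (Ω →ₘ[P] ℝ) → (Ω →ₘ[P] ℝ)) : Prop where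
  mapsTo : ∀ x ∈ X, ρ x ∈ L0 m P
  convex : ∀ η ∈ L0 m P, 0 ≤ η → η ≤ 1 → ∀ x ∈ X, ∀ y ∈ X,
    ρ (η * x + (1 - η) * y) ≤ η * ρ x + (1 - η) * ρ y
  antitone : ∀ x ∈ X, ∀ y ∈ X, x ≤ y → ρ y ≤ ρ x
  cash_invariant : ∀ x ∈ X, ∀ η ∈ L0 m P, ρ (x + η) = ρ x - η

/-- The Lebesgue property of a function on `X`: continuity along dominated almost surely
convergent sequences. -/
def HasLebesgueProperty {Ω : Type*} {m0 : MeasurableSpace Ω} (P : Measure Ω)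
    (X : Set (Ω →ₘ[P] ℝ)) (f : (Ω →ₘ[P] ℝ) → (Ω →ₘ[P] ℝ)) : Prop :=
  ∀ (u : ℕ → (Ω →ₘ[P] ℝ)) (x y : Ω →ₘ[P] ℝ), (∀ n, u n ∈ X) → x ∈ X → y ∈ X →
    (∀ n, |u n| ≤ y) → (∀ᵐ ω ∂P, Tendsto (fun n => u n ω) atTop (𝓝 (x ω))) →
    ∀ᵐ ω ∂P, Tendsto (fun n => f (u n) ω) atTop (𝓝 (f x ω))

/-- The Köthe dual `L⁰(𝓕)`-module of `X`. -/
def koetheDual {Ω : Type*} (m : MeasurableSpace Ω) {m0 : MeasurableSpace Ω} (P : Measure Ω)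
    (X : Set (Ω →ₘ[P] ℝ)) : Set (Ω →ₘ[P] ℝ) :=
  {y | ∀ x ∈ X, x * y ∈ LpF m P 1}

/-- The Fenchel transform `ρ^#(y) = esssup {E[x y | 𝓕] - ρ(x) : x ∈ X}` for `y` in the
Köthe dual of `X`. -/
def fenchel {Ω : Type*} (m : MeasurableSpace Ω) {m0 : MeasurableSpace Ω} (P : Measure Ω)
    [IsFiniteMeasure P] (X : Set (Ω →ₘ[P] ℝ)) (ρ : (Ω →ₘ[P] ℝ) → (Ω →ₘ[P] ℝ))
    (y : koetheDual m P X) : Ω →ₘ[P] EReal :=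
  esssup P {z | ∃ x ∈ X, z =ᵐ[P] fun ω => extCondExp m P (x * y) ω - (ρ x ω : EReal)}

end CondRisk

end

namespace CondRisk

/-! The Lebesgue property is automatic continuity of monotone convex maps. Convexity and
monotonicity give `|ρ(x + u) - ρ(x)| ≤ ρ(x - w) - ρ(x)` whenever `|u| ≤ w`, and `ρ(x - t w) - ρ(x) ≤
t (ρ(x - w) - ρ(x))` for `0 ≤ t ≤ 1`. If `x_n → x` with domination, the tail suprema `d_n = sup_{k ≥
n} |x_k - x|` decrease to `0`, and along suitable indices `d_{φ k} ≤ 2^{-k} s` for one `s` in the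
module (`exists_geometric_control`). So `ρ(x - d_n) - ρ(x)`, which decreases in `n`, tends to `0`.

For the dual representation, integrate: `φ(u) = ∫ (ρ(x + u) - ρ(x)) dP` is a finite convex function
on the bounded measurable `u`, because cash invariance bounds the integrand by `sup |u|`.
Hahn–Banach gives a linear `l ≤ φ`. Monotonicity makes `-l` positive and the Lebesgue property makes
it σ-continuous, so `-l` has a density `f ≥ 0`; the dual variable is `y = -f`.

The scalar inequality becomes conditional because `φ` is local: convexity with `𝓕`-measurable
weights gives `ρ(x + ηu) - ρ(x) ≤ η (ρ(x + u) - ρ(x))`, so it may be tested on every set of `𝓕`.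
Constant directions give `E[f|𝓕] = 1`. The directions `-min(|u|, n)` bound `E[f|u| | 𝓕]` by the
finite variable `ρ(x - |u|) - ρ(x)`, which puts `y` in the Köthe dual. Truncation and the Lebesgue
property extend the subgradient inequality to the whole module, so the supremum defining `ρ^#(y)` is
attained at `x`.

That `y` lies in `L^q_𝓕` is a conditional form of Landau's theorem. Slice by the integer part of
`|f|` and build a test variable from the conditional masses of the slices: if the conclusion failed,
the Abel–Dini theorem on series would contradict the finiteness of its pairing with `f`. -/

theorem condLExp_lt_top_of_le {Ω : Type*} {m m0 : MeasurableSpace Ω} {P : Measure Ω}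
    {X Y : Ω → ℝ≥0∞} (hXY : ∀ᵐ ω ∂P, X ω ≤ Y ω)
    (h : ∀ᵐ ω ∂P, P⁻[Y|m] ω < ∞) : ∀ᵐ ω ∂P, P⁻[X|m] ω < ∞ := by
  filter_upwards [condLExp_mono (mΩ := m) hXY, h] with ω h1 h2 using h1.trans_lt h2

/-! ### Conditional expectation of nonnegative variables and integrating weights -/

section CondLExp

variable {Ω : Type*} {m m0 : MeasurableSpace Ω} {P : Measure Ω} [IsProbabilityMeasure P]

/-- Pull-out property of the conditional Lebesgue expectation. -/
theorem condLExp_mul_left (hm : m ≤ m0) {g X : Ω → ℝ≥0∞} (hg : Measurable[m] g)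
    (hX : AEMeasurable X P) :
    P⁻[fun ω => g ω * X ω|m] =ᵐ[P] fun ω => g ω * P⁻[X|m] ω := by
  -- The measures with densities `X` and `P⁻[X|m]` agree on `m`, hence integrate every
  -- `m`-measurable `k` equally.
  have key : ∀ k : Ω → ℝ≥0∞, Measurable[m] k →
      ∫⁻ ω, k ω * P⁻[X|m] ω ∂P = ∫⁻ ω, k ω * X ω ∂P := by
    intro k hk
    have hk' : Measurable k := hk.mono hm le_rfl
    have h1 : ∫⁻ ω, k ω * P⁻[X|m] ω ∂P = ∫⁻ ω, k ω ∂((P.withDensity P⁻[X|m]).trim hm) := by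
      rw [lintegral_trim hm hk, lintegral_withDensity_eq_lintegral_mul _
        (measurable_condLExp' _ _ _) hk']
      simp [mul_comm]
    have h2 : ∫⁻ ω, k ω * X ω ∂P = ∫⁻ ω, k ω ∂((P.withDensity X).trim hm) := by
      rw [lintegral_trim hm hk, lintegral_withDensity_eq_lintegral_mul₀ hX hk'.aemeasurable]
      simp [mul_comm]
    rw [h1, h2]
    congr 1
    refine @Measure.ext _ m _ _ fun s hs => ?_
    rw [trim_measurableSet_eq hm hs, trim_measurableSet_eq hm hs, withDensity_apply _ (hm s hs),
      withDensity_apply _ (hm s hs), setLIntegral_condLExp hm _ _ hs]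
  refine (ae_eq_condLExp hm P _ (hg.mul (measurable_condLExp _ _ _)) fun s hs => ?_).symm
  rw [← lintegral_indicator (hm s hs), ← lintegral_indicator (hm s hs)]
  have := key (s.indicator g) (hg.indicator hs)
  calc _ = ∫⁻ ω, s.indicator g ω * P⁻[X|m] ω ∂P := by
        congr with ω; by_cases h : ω ∈ s <;> simp [h]
    _ = _ := by
        rw [this]; congr with ω; by_cases h : ω ∈ s <;> simp [h]

/-- A random variable of finite conditional expectation becomes integrable after multiplication
by a suitable positive weight. -/
theorem exists_weight (hm : m ≤ m0) {X : Ω → ℝ≥0∞} (hX : AEMeasurable X P)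
    (h : ∀ᵐ ω ∂P, P⁻[X|m] ω < ∞) :
    ∃ g : Ω → ℝ, Measurable[m] g ∧ (∀ ω, 0 < g ω) ∧ (∀ ω, g ω ≤ 1) ∧
      ∫⁻ ω, ENNReal.ofReal (g ω) * X ω ∂P < ∞ := by
  -- With this weight `g`, pulling out gives `∫ g X = ∫ g P⁻[X|m] ≤ 1`.
  have hg : Measurable[m] fun ω => (1 + (P⁻[X|m] ω).toReal)⁻¹ :=
    (((measurable_condLExp m P X).ennreal_toReal).const_add 1).inv
  refine ⟨fun ω => (1 + (P⁻[X|m] ω).toReal)⁻¹, hg, fun ω => by positivity,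
    fun ω => inv_le_one_of_one_le₀ (by simp), ?_⟩
  rw [← lintegral_condLExp hm P, lintegral_congr_ae (condLExp_mul_left hm hg.ennreal_ofReal hX)]
  refine lt_of_le_of_lt (lintegral_mono_ae (g := fun _ => 1) ?_) (by simp)
  filter_upwards [h] with ω hω
  lift P⁻[X|m] ω to NNReal using hω.ne with c
  rw [ENNReal.coe_toReal, ← ENNReal.ofReal_coe_nnreal, ← ENNReal.ofReal_mul (by positivity)]
  refine ENNReal.ofReal_le_one.2 ?_
  rw [inv_mul_le_iff₀ (by positivity)]
  simp

/-- Converse of `exists_weight`; together they trade conditional finiteness for ordinary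
integrability, where the classical limit theorems apply. -/
theorem condLExp_lt_top_of_weight (hm : m ≤ m0) {X : Ω → ℝ≥0∞} (hX : AEMeasurable X P)
    {g : Ω → ℝ} (hg : Measurable[m] g) (hg0 : ∀ ω, 0 < g ω)
    (h : ∫⁻ ω, ENNReal.ofReal (g ω) * X ω ∂P < ∞) : ∀ᵐ ω ∂P, P⁻[X|m] ω < ∞ := by
  filter_upwards [condLExp_lt_top (mΩ := m) h.ne, condLExp_mul_left hm hg.ennreal_ofReal hX]
    with ω h1 h2
  rw [h2] at h1
  by_contra h3
  rw [not_lt_top_iff.1 h3, ENNReal.mul_top (by simpa using hg0 ω)] at h1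
  exact lt_irrefl _ h1

theorem ae_lt_top_of_condLExp_lt_top (hm : m ≤ m0) {X : Ω → ℝ≥0∞} (hX : AEMeasurable X P)
    (h : ∀ᵐ ω ∂P, P⁻[X|m] ω < ∞) : ∀ᵐ ω ∂P, X ω < ∞ := by
  obtain ⟨g, hg, hg0, -, hgX⟩ := exists_weight hm hX h
  filter_upwards [ae_lt_top' ((hg.mono hm le_rfl).ennreal_ofReal.aemeasurable.mul hX) hgX.ne]
    with ω hω
  by_contra h3
  simp only [Pi.mul_apply] at hω
  rw [not_lt_top_iff.1 h3, ENNReal.mul_top (by simpa using hg0 ω)] at hω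
  exact lt_irrefl _ hω

theorem condLExp_le_of_setLIntegral_le (hm : m ≤ m0) {X Y : Ω → ℝ≥0∞}
    (hY : AEMeasurable[m] Y (P.trim hm))
    (h : ∀ s, MeasurableSet[m] s → ∫⁻ ω in s, X ω ∂P ≤ ∫⁻ ω in s, Y ω ∂P) :
    P⁻[X|m] ≤ᵐ[P] Y := by
  refine ae_le_of_ae_le_trim (hm := hm) ?_
  refine ae_le_of_forall_setLIntegral_le_of_sigmaFinite₀
    (measurable_condLExp m P X).aemeasurable fun s hs _ => ?_
  rw [setLIntegral_condLExp_trim hm _ _ hs, setLIntegral_trim_ae hm hY hs]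
  exact h s hs

end CondLExp

/-! ### The conditional `L^r` module and risk measures at the level of functions -/

/-- Function-level version of membership in `L^r_𝓕(𝓔)`, for a finite exponent `r`. -/
def MemLpF {Ω : Type*} (m : MeasurableSpace Ω) {m0 : MeasurableSpace Ω} (P : Measure Ω) (r : ℝ)
    (f : Ω → ℝ) : Prop :=
  AEStronglyMeasurable f P ∧ ∀ᵐ ω ∂P, P⁻[fun ω' => ‖f ω'‖ₑ ^ r|m] ω < ∞

/-- Function-level version of a conditional risk measure on `L^r_𝓕(𝓔)`. -/
structure IsRiskFunctional {Ω : Type*} (m : MeasurableSpace Ω) {m0 : MeasurableSpace Ω}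
    (P : Measure Ω) (r : ℝ) (R : (Ω → ℝ) → Ω → ℝ) : Prop where
  meas : ∀ f, MemLpF m P r f → AEStronglyMeasurable[m] (R f) P
  convex : ∀ η, Measurable[m] η → (∀ ω, 0 ≤ η ω) → (∀ ω, η ω ≤ 1) → ∀ f g, MemLpF m P r f →
    MemLpF m P r g → ∀ᵐ ω ∂P, R (fun ω => η ω * f ω + (1 - η ω) * g ω) ω ≤
      η ω * R f ω + (1 - η ω) * R g ω
  antitone : ∀ f g, MemLpF m P r f → MemLpF m P r g → f ≤ᵐ[P] g → R g ≤ᵐ[P] R f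
  cash_invariant : ∀ f η, MemLpF m P r f → Measurable[m] η →
    ∀ᵐ ω ∂P, R (fun ω => f ω + η ω) ω = R f ω - η ω
  congr : ∀ f g, f =ᵐ[P] g → R f =ᵐ[P] R g

section MemLpF

variable {Ω : Type*} {m m0 : MeasurableSpace Ω} {P : Measure Ω} {r : ℝ} {f g : Ω → ℝ}

theorem MemLpF.mono (hr : 0 ≤ r) (hg : MemLpF m P r g) (hf : AEStronglyMeasurable f P)
    (h : ∀ᵐ ω ∂P, |f ω| ≤ |g ω|) : MemLpF m P r f := by
  refine ⟨hf, condLExp_lt_top_of_le ?_ hg.2⟩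
  filter_upwards [h] with ω hω
  exact ENNReal.rpow_le_rpow (enorm_le_iff_norm_le.2 hω) hr

theorem MemLpF.congr (hr : 0 ≤ r) (hg : MemLpF m P r g) (h : f =ᵐ[P] g) : MemLpF m P r f :=
  hg.mono hr (hg.1.congr h.symm) (h.mono fun ω hω => by rw [hω])

theorem MemLpF.neg (hr : 0 ≤ r) (hf : MemLpF m P r f) : MemLpF m P r fun ω => -f ω :=
  hf.mono hr hf.1.neg (by simp)

theorem MemLpF.abs (hr : 0 ≤ r) (hf : MemLpF m P r f) : MemLpF m P r fun ω => |f ω| :=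
  hf.mono hr hf.1.norm (by simp)

theorem MemLpF.add (hr : 1 ≤ r) (hf : MemLpF m P r f) (hg : MemLpF m P r g) :
    MemLpF m P r fun ω => f ω + g ω := by
  refine ⟨hf.1.add hg.1, condLExp_lt_top_of_le (Y := fun ω =>
    ((2 : ℝ≥0∞) ^ (r - 1) * ‖f ω‖ₑ ^ r) + ((2 : ℝ≥0∞) ^ (r - 1) * ‖g ω‖ₑ ^ r))
    (.of_forall fun ω => ?_) ?_⟩
  · rw [← mul_add]
    exact (ENNReal.rpow_le_rpow (enorm_add_le _ _) (by linarith)).trans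
      (ENNReal.rpow_add_le_mul_rpow_add_rpow _ _ hr)
  · have h2 : (2 : ℝ≥0∞) ^ (r - 1) < ∞ := ENNReal.rpow_lt_top_of_nonneg (by linarith) (by simp)
    filter_upwards [condLExp_add_left (mΩ := m) (fun ω => (2 : ℝ≥0∞) ^ (r - 1) * ‖g ω‖ₑ ^ r)
        ((hf.1.enorm.pow_const r).const_mul ((2 : ℝ≥0∞) ^ (r - 1))),
      condLExp_smul (mΩ := m) _ (hf.1.enorm.pow_const r) ((2 : ℝ≥0∞) ^ (r - 1)),
      condLExp_smul (mΩ := m) _ (hg.1.enorm.pow_const r) ((2 : ℝ≥0∞) ^ (r - 1)), hf.2, hg.2]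
      with ω h3 h4 h5 h6 h7
    refine lt_of_eq_of_lt h3 ?_
    refine ENNReal.add_lt_top.2 ⟨lt_of_eq_of_lt h4 (ENNReal.mul_lt_top h2 h6),
      lt_of_eq_of_lt h5 (ENNReal.mul_lt_top h2 h7)⟩

theorem MemLpF.sub (hr : 1 ≤ r) (hf : MemLpF m P r f) (hg : MemLpF m P r g) :
    MemLpF m P r fun ω => f ω - g ω := by
  simpa [sub_eq_add_neg] using hf.add hr (hg.neg (by linarith))

theorem memLpF_of_measurable [IsProbabilityMeasure P] (hm : m ≤ m0) (hr : 0 ≤ r)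
    (hf : Measurable[m] f) : MemLpF m P r f := by
  refine ⟨(hf.mono hm le_rfl).aestronglyMeasurable, ?_⟩
  rw [condLExp_eq_self hm P (by fun_prop)]
  exact .of_forall fun ω => ENNReal.rpow_lt_top_of_nonneg hr (by simp)

theorem MemLpF.of_bounded [IsProbabilityMeasure P] (hm : m ≤ m0) (hr : 0 ≤ r)
    (hf : AEStronglyMeasurable f P) {C : ℝ} (hC : ∀ᵐ ω ∂P, |f ω| ≤ C) : MemLpF m P r f :=
  (memLpF_of_measurable hm hr (measurable_const (a := C))).mono hr hf
    (hC.mono fun _ h => h.trans (le_abs_self C))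

/-- A sequence converging to zero that is dominated in `L^r_𝓕(𝓔)` converges, along a subsequence,
at a geometric rate with respect to some element of `L^r_𝓕(𝓔)`. -/
theorem exists_geometric_control [IsProbabilityMeasure P] (hm : m ≤ m0) (hr : 1 ≤ r)
    {z : ℕ → Ω → ℝ} {y : Ω → ℝ} (hz : ∀ n, AEStronglyMeasurable (z n) P) (hy : MemLpF m P r y)
    (hzy : ∀ n, ∀ᵐ ω ∂P, |z n ω| ≤ |y ω|)
    (hlim : ∀ᵐ ω ∂P, Tendsto (fun n => z n ω) atTop (𝓝 0)) :
    ∃ (s : Ω → ℝ) (φ : ℕ → ℕ), MemLpF m P r s ∧ (∀ ω, 0 ≤ s ω) ∧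
      ∀ k, ∀ᵐ ω ∂P, |z (φ k) ω| ≤ (2 : ℝ)⁻¹ ^ k * s ω := by
  have hr0 : 0 < r := by linarith
  obtain ⟨g, hg, hg0, hg1, hgy⟩ := exists_weight hm (hy.1.enorm.pow_const r) hy.2
  have hg' : Measurable g := hg.mono hm le_rfl
  have hgm := hg'.ennreal_ofReal
  have hlim' : Tendsto (fun n => ∫⁻ ω, ENNReal.ofReal (g ω) * ‖z n ω‖ₑ ^ r ∂P) atTop (𝓝 0) := by
    have := tendsto_lintegral_of_dominated_convergence' (μ := P)
      (F := fun n ω => ENNReal.ofReal (g ω) * ‖z n ω‖ₑ ^ r) (f := fun _ => 0)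
      (fun ω => ENNReal.ofReal (g ω) * ‖y ω‖ₑ ^ r)
      (fun n => hgm.aemeasurable.mul ((hz n).enorm.pow_const r)) (fun n => ?_) hgy.ne ?_
    · simpa using this
    · filter_upwards [hzy n] with ω hω
      gcongr
      exact enorm_le_iff_norm_le.2 hω
    · filter_upwards [hlim] with ω hω
      have h1 : Tendsto (fun n => ‖z n ω‖ₑ ^ r) atTop (𝓝 (‖(0 : ℝ)‖ₑ ^ r)) :=
        (ENNReal.continuous_rpow_const.tendsto _).comp ((continuous_enorm.tendsto _).comp hω)
      rw [enorm_zero, ENNReal.zero_rpow_of_pos hr0] at h1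
      simpa using ENNReal.Tendsto.const_mul h1 (Or.inr ENNReal.ofReal_ne_top)
  -- The factor `2^{kr}` turns a bound on one term of the series `S` below into `2^k |z_{φ k}| ≤
  -- S^{1/r}`. The choice of `φ` leaves a surplus `2^{-k}`, which makes the weighted integral of `S`
  -- finite. Monotonicity of `φ` is not required.
  let c : ℕ → ℝ≥0∞ := fun k => ((2 : ℝ≥0∞) ^ k) ^ r
  have hc0 : ∀ k, c k ≠ 0 := fun k => by simp [c]
  have hct : ∀ k, c k ≠ ∞ := fun k => by simp [c, ENNReal.rpow_eq_top_iff]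
  have hex : ∀ k, ∃ n, ∫⁻ ω, ENNReal.ofReal (g ω) * ‖z n ω‖ₑ ^ r ∂P < (2 : ℝ≥0∞)⁻¹ ^ k * (c k)⁻¹ :=
    fun k => (hlim'.eventually (gt_mem_nhds (ENNReal.mul_pos (by simp)
      (ENNReal.inv_ne_zero.2 (hct k))))).exists
  choose φ hφ using hex
  let S : Ω → ℝ≥0∞ := fun ω => ∑' k, c k * ‖z (φ k) ω‖ₑ ^ r
  have hSm : AEMeasurable S P :=
    AEMeasurable.tsum fun k => ((hz (φ k)).enorm.pow_const r).const_mul _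
  have hgS : ∫⁻ ω, ENNReal.ofReal (g ω) * S ω ∂P < ∞ := by
    have : ∀ ω, ENNReal.ofReal (g ω) * S ω =
        ∑' k, c k * (ENNReal.ofReal (g ω) * ‖z (φ k) ω‖ₑ ^ r) := fun ω => by
      rw [← ENNReal.tsum_mul_left]
      exact tsum_congr fun k => by ring
    simp_rw [this]
    have hmeas : ∀ k, AEMeasurable (fun ω => c k * (ENNReal.ofReal (g ω) * ‖z (φ k) ω‖ₑ ^ r)) P :=
      fun k => (hgm.aemeasurable.mul ((hz (φ k)).enorm.pow_const r)).const_mul _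
    rw [lintegral_tsum hmeas]
    refine lt_of_le_of_lt (ENNReal.tsum_le_tsum (g := fun k => (2 : ℝ≥0∞)⁻¹ ^ k) fun k => ?_) ?_
    · rw [lintegral_const_mul' _ _ (hct k)]
      calc _ ≤ c k * ((2 : ℝ≥0∞)⁻¹ ^ k * (c k)⁻¹) := by gcongr; exact (hφ k).le
        _ = (2 : ℝ≥0∞)⁻¹ ^ k * (c k * (c k)⁻¹) := by ring
        _ = _ := by rw [ENNReal.mul_inv_cancel (hc0 k) (hct k), mul_one]
    · rw [ENNReal.tsum_geometric]; simp
  have hS := condLExp_lt_top_of_weight hm hSm hg hg0 hgS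
  have hSt := ae_lt_top_of_condLExp_lt_top hm hSm hS
  refine ⟨fun ω => (S ω ^ r⁻¹).toReal, φ,
    ⟨(hSm.pow_const _).ennreal_toReal.aestronglyMeasurable, condLExp_lt_top_of_le ?_ hS⟩,
    fun ω => ENNReal.toReal_nonneg, fun k => ?_⟩
  · filter_upwards [hSt] with ω hω
    rw [Real.enorm_eq_ofReal ENNReal.toReal_nonneg, ENNReal.ofReal_toReal
      (ENNReal.rpow_lt_top_of_nonneg (by positivity) hω.ne).ne, ENNReal.rpow_inv_rpow hr0.ne']
  · filter_upwards [hSt] with ω hω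
    have h1 : (2 ^ k * ‖z (φ k) ω‖ₑ) ^ r ≤ S ω := by
      rw [ENNReal.mul_rpow_of_nonneg _ _ hr0.le]
      exact ENNReal.le_tsum k
    have h2 : 2 ^ k * ‖z (φ k) ω‖ₑ ≤ S ω ^ r⁻¹ := by
      have := ENNReal.rpow_le_rpow h1 (inv_nonneg.2 hr0.le)
      rwa [ENNReal.rpow_rpow_inv hr0.ne'] at this
    have h3 := ENNReal.toReal_mono (ENNReal.rpow_lt_top_of_nonneg (by positivity) hω.ne).ne h2
    rw [ENNReal.toReal_mul, toReal_enorm, Real.norm_eq_abs] at h3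
    simp only [ENNReal.toReal_pow, ENNReal.toReal_ofNat] at h3
    rw [inv_pow, ← div_eq_inv_mul, le_div_iff₀ (by positivity), mul_comm]
    exact h3

end MemLpF

/-! ### Automatic continuity: the Lebesgue property -/

section Lebesgue

variable {Ω : Type*} {m m0 : MeasurableSpace Ω} {P : Measure Ω} {r : ℝ}
  {R : (Ω → ℝ) → Ω → ℝ} {x u w : Ω → ℝ}

theorem IsRiskFunctional.sub_convex (hR : IsRiskFunctional m P r R) (hr : 1 ≤ r)
    (hx : MemLpF m P r x) (hu : MemLpF m P r u) {η : Ω → ℝ} (hη : Measurable[m] η)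
    (h0 : ∀ ω, 0 ≤ η ω) (h1 : ∀ ω, η ω ≤ 1) :
    ∀ᵐ ω ∂P, R (fun ω => x ω + η ω * u ω) ω - R x ω ≤
      η ω * (R (fun ω => x ω + u ω) ω - R x ω) := by
  filter_upwards [hR.convex η hη h0 h1 (fun ω => x ω + u ω) x (hx.add hr hu) hx] with ω hω
  have : (fun ω => η ω * (x ω + u ω) + (1 - η ω) * x ω) = fun ω => x ω + η ω * u ω := by
    ext ω; ring
  rw [this] at hω
  linarith

/-- The upper bound is monotonicity. For the lower bound, `x` is the midpoint of `x + w` and `x -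
w`, so the decrease towards `x + w` is at most the increase towards `x - w`. -/
theorem IsRiskFunctional.abs_sub_le (hR : IsRiskFunctional m P r R) (hr : 1 ≤ r)
    (hx : MemLpF m P r x) (hu : MemLpF m P r u) (hw : MemLpF m P r w)
    (huw : ∀ᵐ ω ∂P, |u ω| ≤ w ω) :
    ∀ᵐ ω ∂P, |R (fun ω => x ω + u ω) ω - R x ω| ≤ R (fun ω => x ω - w ω) ω - R x ω := by
  have hp := hx.add hr hw
  have hn := hx.sub hr hw
  have hc := hR.convex (fun _ => 2⁻¹) measurable_const (by intro; norm_num)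
    (by intro; norm_num) _ _ hp hn
  have he : (fun ω => (2⁻¹ : ℝ) * (x ω + w ω) + (1 - 2⁻¹) * (x ω - w ω)) = x := by
    ext ω; ring
  rw [he] at hc
  filter_upwards [hc, hR.antitone _ _ hn (hx.add hr hu)
      (huw.mono fun ω h => by linarith [abs_le.1 h]),
    hR.antitone _ _ (hx.add hr hu) hp (huw.mono fun ω h => by
      have := abs_le.1 h
      show x ω + u ω ≤ x ω + w ω
      linarith)] with ω h1 h2 h3
  rw [abs_le]
  constructor <;> linarith

/-- Continuity of risk functionals along dominated almost surely convergent sequences. -/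
theorem IsRiskFunctional.tendsto [IsProbabilityMeasure P] (hm : m ≤ m0)
    (hR : IsRiskFunctional m P r R) (hr : 1 ≤ r) {v : ℕ → Ω → ℝ} {y : Ω → ℝ}
    (hv : ∀ n, MemLpF m P r (v n)) (hx : MemLpF m P r x) (hy : MemLpF m P r y)
    (hvy : ∀ n, ∀ᵐ ω ∂P, |v n ω| ≤ y ω)
    (hlim : ∀ᵐ ω ∂P, Tendsto (fun n => v n ω) atTop (𝓝 (x ω))) :
    ∀ᵐ ω ∂P, Tendsto (fun n => R (v n) ω) atTop (𝓝 (R x ω)) := by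
  have hr0 : 0 ≤ r := by linarith
  let b : Ω → ℝ := fun ω => y ω + |x ω|
  have hb : MemLpF m P r b := hy.add hr (hx.abs hr0)
  -- Passing to tail suprema makes the errors decreasing, so control along the indices `φ k`
  -- suffices. The real supremum takes a default value only on the null set where the errors are
  -- unbounded.
  let d : ℕ → Ω → ℝ := fun n ω => ⨆ k, |v (n + k) ω - x ω|
  have hvy' := ae_all_iff.2 hvy
  have hbd : ∀ᵐ ω ∂P, ∀ n, |v n ω - x ω| ≤ b ω := by
    filter_upwards [hvy'] with ω h n
    exact (abs_sub _ _).trans (by simpa [b] using h n)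
  have hdb : ∀ᵐ ω ∂P, ∀ n, BddAbove (Set.range fun k => |v (n + k) ω - x ω|) := by
    filter_upwards [hbd] with ω h n
    exact ⟨b ω, by rintro _ ⟨k, rfl⟩; exact h _⟩
  have hdm : ∀ n, AEStronglyMeasurable (d n) P := fun n =>
    (AEMeasurable.iSup fun k =>
      (((hv (n + k)).1.sub hx.1).norm.aemeasurable)).aestronglyMeasurable
  have hd0 : ∀ n ω, 0 ≤ d n ω := fun n ω => Real.iSup_nonneg fun k => abs_nonneg _
  have hdle : ∀ᵐ ω ∂P, ∀ n, d n ω ≤ b ω := by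
    filter_upwards [hbd] with ω h n using ciSup_le fun k => h _
  have hdL : ∀ n, MemLpF m P r (d n) := fun n => hb.mono hr0 (hdm n) <| by
    filter_upwards [hdle] with ω h
    rw [abs_of_nonneg (hd0 n ω)]
    exact (h n).trans (le_abs_self _)
  have hvd : ∀ n, ∀ᵐ ω ∂P, |v n ω - x ω| ≤ d n ω := fun n => by
    filter_upwards [hdb] with ω h
    exact le_ciSup (h n) 0
  have hdanti : ∀ᵐ ω ∂P, Antitone fun n => d n ω := by
    filter_upwards [hdb] with ω h i j hij
    refine ciSup_le fun k => ?_
    obtain ⟨l, rfl⟩ := Nat.exists_eq_add_of_le hij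
    rw [add_assoc]
    exact le_ciSup (h i) (l + k)
  have hdlim : ∀ᵐ ω ∂P, Tendsto (fun n => d n ω) atTop (𝓝 0) := by
    filter_upwards [hlim] with ω h
    refine Metric.tendsto_atTop.2 fun ε hε => ?_
    obtain ⟨N, hN⟩ := Metric.tendsto_atTop.1 h (ε / 2) (by positivity)
    refine ⟨N, fun n hn => ?_⟩
    rw [Real.dist_eq, sub_zero, abs_of_nonneg (hd0 n ω)]
    refine lt_of_le_of_lt (ciSup_le fun k => ?_) (half_lt_self hε)
    exact (hN (n + k) (by omega)).le
  obtain ⟨s, φ, hs, hs0, hφ⟩ := exists_geometric_control hm hr hdm hb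
    (fun n => by
      filter_upwards [hdle] with ω h
      rw [abs_of_nonneg (hd0 n ω)]
      exact (h n).trans (le_abs_self _)) hdlim
  let h : (Ω → ℝ) → Ω → ℝ := fun w ω => R (fun ω => x ω - w ω) ω - R x ω
  have hmono : ∀ w w', MemLpF m P r w → MemLpF m P r w' → w ≤ᵐ[P] w' → h w ≤ᵐ[P] h w' := by
    intro w w' hw hw' hle
    filter_upwards [hR.antitone _ _ (hx.sub hr hw') (hx.sub hr hw)
      (hle.mono fun ω h => sub_le_sub_left h (x ω))] with ω h1
    exact sub_le_sub_right h1 _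
  have hgeo : ∀ k, ∀ᵐ ω ∂P, h (d (φ k)) ω ≤ (2 : ℝ)⁻¹ ^ k * h s ω := by
    intro k
    have ht0 : (0 : ℝ) ≤ 2⁻¹ ^ k := by positivity
    have ht1 : (2 : ℝ)⁻¹ ^ k ≤ 1 := pow_le_one₀ (by norm_num) (by norm_num)
    have hsk : MemLpF m P r fun ω => (2 : ℝ)⁻¹ ^ k * s ω := hs.mono hr0 (hs.1.const_mul _)
      (.of_forall fun ω => by
        rw [abs_mul, abs_of_nonneg ht0]; exact mul_le_of_le_one_left (abs_nonneg _) ht1)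
    have h1 := hR.sub_convex hr hx (hs.neg hr0) (η := fun _ => (2 : ℝ)⁻¹ ^ k) measurable_const
      (fun _ => ht0) (fun _ => ht1)
    simp only [mul_neg, ← sub_eq_add_neg] at h1
    filter_upwards [h1, hmono _ _ (hdL (φ k)) hsk ((hφ k).mono fun ω h =>
      (le_abs_self _).trans h)] with ω h2 h3 using h3.trans h2
  have hhm : ∀ᵐ ω ∂P, Antitone fun n => h (d n) ω := by
    have : ∀ᵐ ω ∂P, ∀ n, h (d (n + 1)) ω ≤ h (d n) ω := ae_all_iff.2 fun n =>
      hmono _ _ (hdL _) (hdL _) (hdanti.mono fun ω h => h (Nat.le_succ n))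
    filter_upwards [this] with ω h using antitone_nat_of_succ_le h
  have habs : ∀ n, ∀ᵐ ω ∂P, |R (v n) ω - R x ω| ≤ h (d n) ω := by
    intro n
    have := hR.abs_sub_le hr hx ((hv n).sub hr hx) (hdL n) (hvd n)
    simpa using this
  filter_upwards [ae_all_iff.2 habs, hhm, ae_all_iff.2 hgeo] with ω h1 h2 h3
  rw [tendsto_iff_dist_tendsto_zero]
  have h4 : Tendsto (fun k => (2 : ℝ)⁻¹ ^ k * h s ω) atTop (𝓝 0) := by
    simpa using (tendsto_pow_atTop_nhds_zero_of_lt_one (r := (2 : ℝ)⁻¹) (by norm_num)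
      (by norm_num)).mul_const (h s ω)
  refine Metric.tendsto_atTop.2 fun ε hε => ?_
  obtain ⟨k, hk⟩ := (h4.eventually (gt_mem_nhds hε)).exists
  refine ⟨φ k, fun n hn => ?_⟩
  rw [Real.dist_eq, sub_zero, abs_of_nonneg dist_nonneg, Real.dist_eq]
  exact ((h1 n).trans (h2 hn)).trans_lt ((h3 k).trans_lt hk)

end Lebesgue

/-! ### A linear minorant of a convex function -/

section HahnBanach

/-- A real convex function vanishing at the origin dominates a linear functional. -/
theorem exists_linearMap_le_of_convexOn {E : Type*} [AddCommGroup E] [Module ℝ E] {φ : E → ℝ}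
    (hφ : ConvexOn ℝ Set.univ φ) (h0 : φ 0 = 0) : ∃ l : E →ₗ[ℝ] ℝ, ∀ x, l x ≤ φ x := by
  -- This is the one-sided directional derivative of `φ` at the origin, the sublinear function to
  -- which Hahn–Banach applies.
  let N : E → ℝ := fun x => ⨅ t : Set.Ioi (0 : ℝ), (t : ℝ)⁻¹ * φ ((t : ℝ) • x)
  have hbdd : ∀ x, BddBelow (Set.range fun t : Set.Ioi (0 : ℝ) => (t : ℝ)⁻¹ * φ ((t : ℝ) • x)) := by
    refine fun x => ⟨-φ (-x), ?_⟩
    rintro _ ⟨⟨t, ht⟩, rfl⟩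
    have ht : 0 < t := ht
    -- The origin is a convex combination of `t • x` and `-x`, which bounds the difference quotients
    -- below by `-φ (-x)`.
    have h1 := hφ.2 (Set.mem_univ (t • x)) (Set.mem_univ (-x))
      (by positivity : 0 ≤ 1 / (1 + t)) (by positivity : 0 ≤ t / (1 + t)) (by field_simp)
    have h2 : (1 / (1 + t)) • t • x + (t / (1 + t)) • -x = 0 := by
      rw [smul_smul, smul_neg, one_div_mul_eq_div, add_neg_cancel]
    rw [h2, h0, smul_eq_mul, smul_eq_mul] at h1
    have h3 : 0 ≤ φ (t • x) + t * φ (-x) := by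
      have := mul_nonneg (by positivity : 0 ≤ 1 + t) h1
      have h4 : (1 + t) * (1 / (1 + t) * φ (t • x) + t / (1 + t) * φ (-x)) =
          φ (t • x) + t * φ (-x) := by field_simp
      rwa [h4] at this
    show -φ (-x) ≤ t⁻¹ * φ (t • x)
    rw [le_inv_mul_iff₀ ht]
    linarith
  have hle : ∀ x (t : ℝ), 0 < t → N x ≤ t⁻¹ * φ (t • x) := fun x t ht => ciInf_le (hbdd x) ⟨t, ht⟩
  have hne : Nonempty (Set.Ioi (0 : ℝ)) := ⟨⟨1, Set.mem_Ioi.2 one_pos⟩⟩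
  have hhom' : ∀ c : ℝ, 0 < c → ∀ x, N (c • x) ≤ c * N x := by
    intro c hc x
    rw [← inv_mul_le_iff₀ hc]
    refine le_ciInf ?_
    rintro ⟨t, ht⟩
    have ht : 0 < t := ht
    rw [inv_mul_le_iff₀ hc]
    refine (hle (c • x) (t * c⁻¹) (by positivity)).trans (le_of_eq ?_)
    rw [smul_smul, inv_mul_cancel_right₀ hc.ne']
    field_simp
  have hhom : ∀ c : ℝ, 0 < c → ∀ x, N (c • x) = c * N x := by
    intro c hc x
    refine le_antisymm (hhom' c hc x) ?_
    have := hhom' c⁻¹ (inv_pos.2 hc) (c • x)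
    rw [smul_smul, inv_mul_cancel₀ hc.ne', one_smul] at this
    rwa [le_inv_mul_iff₀ hc] at this
  have hadd : ∀ x y, N (x + y) ≤ N x + N y := by
    intro x y
    rw [← sub_le_iff_le_add]
    refine le_ciInf ?_
    rintro ⟨s, hs⟩
    rw [sub_le_comm]
    refine le_ciInf ?_
    rintro ⟨t, ht⟩
    have hs : 0 < s := hs
    have ht : 0 < t := ht
    rw [sub_le_iff_le_add]
    -- The harmonic step size makes the dilate of `x + y` a convex combination of `s • x` and `t •
    -- y`, with weights that cancel in the quotients.
    refine (hle (x + y) (s * t / (s + t)) (by positivity)).trans ?_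
    rw [inv_mul_le_iff₀ (by positivity)]
    have h1 := hφ.2 (Set.mem_univ (s • x)) (Set.mem_univ (t • y))
      (by positivity : 0 ≤ t / (s + t)) (by positivity : 0 ≤ s / (s + t)) (by field_simp; ring)
    have h2 : (t / (s + t)) • s • x + (s / (s + t)) • t • y = (s * t / (s + t)) • (x + y) := by
      rw [smul_smul, smul_smul, smul_add]
      congr 2 <;> ring
    rw [h2, smul_eq_mul, smul_eq_mul] at h1
    refine h1.trans (le_of_eq ?_)
    dsimp only
    field_simp
    ring
  have hN0 : N 0 = 0 := by
    have := hhom 2 two_pos 0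
    rw [smul_zero] at this
    linarith
  obtain ⟨l, -, hl⟩ := exists_extension_of_le_sublinear (⊥ : E →ₗ.[ℝ] ℝ) N hhom hadd (by
    rintro ⟨x, hx⟩
    have hx0 : x = 0 := (Submodule.mem_bot ℝ).1 hx
    subst hx0
    rw [hN0]
    exact (LinearPMap.map_zero _).le)
  exact ⟨l, fun x => (hl x).trans (by simpa using hle x 1 one_pos)⟩

end HahnBanach

/-! ### Representation of σ-continuous positive functionals by densities -/

section Density

/-- The bounded measurable real functions. -/
def boundedMeasurable (Ω : Type*) [MeasurableSpace Ω] : Submodule ℝ (Ω → ℝ) where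
  carrier := {f | Measurable f ∧ ∃ C, ∀ ω, |f ω| ≤ C}
  add_mem' := by
    rintro f g ⟨hf, C, hC⟩ ⟨hg, D, hD⟩
    exact ⟨hf.add hg, C + D, fun ω => (abs_add_le _ _).trans (add_le_add (hC ω) (hD ω))⟩
  zero_mem' := ⟨measurable_zero, 0, by simp⟩
  smul_mem' := by
    rintro c f ⟨hf, C, hC⟩
    refine ⟨hf.const_smul c, |c| * C, fun ω => ?_⟩
    rw [Pi.smul_apply, smul_eq_mul, abs_mul]
    exact mul_le_mul_of_nonneg_left (hC ω) (abs_nonneg c)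

variable {Ω : Type*} [MeasurableSpace Ω]

theorem indicator_mem_boundedMeasurable {s : Set Ω} (hs : MeasurableSet s) :
    s.indicator (fun _ => (1 : ℝ)) ∈ boundedMeasurable Ω :=
  ⟨measurable_const.indicator hs, 1, fun ω => by by_cases h : ω ∈ s <;> simp [h]⟩

/-- A positive linear functional on the bounded measurable functions that is continuous along
bounded pointwise convergent sequences and vanishes on null functions has a density. -/
theorem exists_density {P : Measure Ω} [IsFiniteMeasure P] (l : boundedMeasurable Ω →ₗ[ℝ] ℝ)
    (hpos : ∀ u : boundedMeasurable Ω, (∀ ω, 0 ≤ u.1 ω) → 0 ≤ l u)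
    (hnull : ∀ u : boundedMeasurable Ω, u.1 =ᵐ[P] 0 → l u = 0)
    (hcont : ∀ (u : ℕ → boundedMeasurable Ω) (v : boundedMeasurable Ω) (C : ℝ),
      (∀ n ω, |(u n).1 ω| ≤ C) → (∀ ω, Tendsto (fun n => (u n).1 ω) atTop (𝓝 (v.1 ω))) →
      Tendsto (fun n => l (u n)) atTop (𝓝 (l v))) :
    ∃ f : Ω → ℝ, Measurable f ∧ (∀ ω, 0 ≤ f ω) ∧ Integrable f P ∧
      ∀ u : boundedMeasurable Ω, l u = ∫ ω, f ω * u.1 ω ∂P := by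
  let ind : ∀ s : Set Ω, MeasurableSet s → boundedMeasurable Ω := fun s hs =>
    ⟨s.indicator fun _ => 1, indicator_mem_boundedMeasurable hs⟩
  have hind0 : ∀ s hs, 0 ≤ l (ind s hs) := fun s hs =>
    hpos _ fun ω => Set.indicator_nonneg (fun _ _ => zero_le_one) ω
  -- Countable additivity is `hcont` applied to the indicators of the finite unions; `hnull` later
  -- gives `ν ≪ P`, and the density is the Radon–Nikodym derivative.
  let ν : Measure Ω := Measure.ofMeasurable (fun s hs => ENNReal.ofReal (l (ind s hs)))
    (by
      rw [hnull _ (by simp [ind]; rfl), ENNReal.ofReal_zero])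
    (by
      intro s hs hd
      have hacc : ∀ n, MeasurableSet (⋃ i ∈ Finset.range n, s i) := fun n =>
        Finset.measurableSet_biUnion _ fun i _ => hs i
      have hsum : ∀ n, ∑ i ∈ Finset.range n, ENNReal.ofReal (l (ind (s i) (hs i))) =
          ENNReal.ofReal (l (ind _ (hacc n))) := by
        intro n
        rw [← ENNReal.ofReal_sum_of_nonneg fun i _ => hind0 _ _, ← map_sum]
        swap
        · exact hs
        congr 2
        refine Subtype.ext ?_
        rw [Submodule.coe_sum]
        simp only [ind]
        rw [Finset.indicator_biUnion]
        · ext ω; simp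
        · exact fun i _ j _ hij => hd hij
      have h1 := ENNReal.tendsto_nat_tsum fun i => ENNReal.ofReal (l (ind (s i) (hs i)))
      simp_rw [hsum] at h1
      refine tendsto_nhds_unique (ENNReal.tendsto_ofReal (hcont _ _ 1 ?_ ?_)) h1
      · intro n ω
        simp only [ind]
        by_cases h : ω ∈ ⋃ i ∈ Finset.range n, s i
        · rw [Set.indicator_of_mem h]; simp
        · rw [Set.indicator_of_notMem h]; simp
      · intro ω
        simp only [ind]
        by_cases h : ω ∈ ⋃ i, s i
        · obtain ⟨i, hi⟩ := Set.mem_iUnion.1 h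
          refine tendsto_const_nhds.congr' ?_
          filter_upwards [eventually_gt_atTop i] with n hn
          rw [Set.indicator_of_mem h, Set.indicator_of_mem]
          exact Set.mem_biUnion (Finset.mem_coe.2 (Finset.mem_range.2 hn)) hi
        · refine tendsto_const_nhds.congr fun n => ?_
          rw [Set.indicator_of_notMem h, Set.indicator_of_notMem]
          intro h'
          obtain ⟨i, -, hi⟩ := Set.mem_iUnion₂.1 h'
          exact h (Set.mem_iUnion.2 ⟨i, hi⟩))
  have hν : ∀ s (hs : MeasurableSet s), ν s = ENNReal.ofReal (l (ind s hs)) :=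
    fun s hs => Measure.ofMeasurable_apply s hs
  have hνfin : IsFiniteMeasure ν := ⟨by rw [hν _ .univ]; exact ENNReal.ofReal_lt_top⟩
  have hac : ν ≪ P := Measure.AbsolutelyContinuous.mk fun s hs h0 => by
    rw [hν s hs, hnull, ENNReal.ofReal_zero]
    exact indicator_meas_zero h0
  have hsimple : ∀ (f : SimpleFunc Ω ℝ) (h : ⇑f ∈ boundedMeasurable Ω),
      l ⟨f, h⟩ = ∫ ω, f ω ∂ν := by
    intro f
    refine SimpleFunc.induction (motive := fun f => ∀ h : ⇑f ∈ boundedMeasurable Ω,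
      l ⟨f, h⟩ = ∫ ω, f ω ∂ν) ?_ ?_ f
    · intro c s hs h
      have h1 : (⟨_, h⟩ : boundedMeasurable Ω) = c • ind s hs := by
        refine Subtype.ext ?_
        ext ω
        by_cases hω : ω ∈ s <;> simp [ind, hω]
      rw [h1, map_smul]
      have h2 : ∀ ω, (SimpleFunc.piecewise s hs (SimpleFunc.const Ω c) (SimpleFunc.const Ω 0)) ω =
          s.indicator (fun _ => c) ω := fun ω => by
        by_cases hω : ω ∈ s <;> simp [hω]
      simp_rw [h2]
      rw [integral_indicator_const _ hs, measureReal_def, hν s hs,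
        ENNReal.toReal_ofReal (hind0 s hs), smul_eq_mul, smul_eq_mul, mul_comm]
    · intro f g _ hf hg h
      have hb : ∀ f : SimpleFunc Ω ℝ, ⇑f ∈ boundedMeasurable Ω := fun f =>
        ⟨f.measurable, (f.exists_forall_norm_le)⟩
      have h1 : (⟨_, h⟩ : boundedMeasurable Ω) = ⟨f, hb f⟩ + ⟨g, hb g⟩ := Subtype.ext rfl
      rw [h1, map_add, hf, hg, ← integral_add]
      · rfl
      · exact SimpleFunc.integrable_of_isFiniteMeasure f
      · exact SimpleFunc.integrable_of_isFiniteMeasure g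
  have hint : ∀ u : boundedMeasurable Ω, l u = ∫ ω, u.1 ω ∂ν := by
    rintro ⟨u, hu, C, hC⟩
    have hsm := hu.stronglyMeasurable
    have hC0 : 0 ≤ max C 0 := le_max_right _ _
    have hb : ∀ n ω, ‖hsm.approxBounded (max C 0) n ω‖ ≤ max C 0 := fun n ω =>
      hsm.norm_approxBounded_le hC0 n ω
    have hlim : ∀ ω, Tendsto (fun n => hsm.approxBounded (max C 0) n ω) atTop (𝓝 (u ω)) :=
      fun ω => hsm.tendsto_approxBounded_of_norm_le ((hC ω).trans (le_max_left _ _))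
    have h1 := hcont (fun n => ⟨hsm.approxBounded (max C 0) n,
      (hsm.approxBounded (max C 0) n).measurable, max C 0, hb n⟩) ⟨u, hu, C, hC⟩ (max C 0) hb hlim
    have h2 : ∀ n, l ⟨hsm.approxBounded (max C 0) n, (hsm.approxBounded (max C 0) n).measurable,
        max C 0, hb n⟩ = ∫ ω, hsm.approxBounded (max C 0) n ω ∂ν := fun n => hsimple _ _
    refine tendsto_nhds_unique (h1.congr h2) (tendsto_integral_of_dominated_convergence (fun _ => max C 0)
      (fun n => (hsm.approxBounded (max C 0) n).aestronglyMeasurable) (integrable_const _)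
      (fun n => .of_forall (hb n)) (.of_forall hlim))
  refine ⟨fun ω => (ν.rnDeriv P ω).toReal, (Measure.measurable_rnDeriv _ _).ennreal_toReal,
    fun ω => ENNReal.toReal_nonneg, Measure.integrable_toReal_rnDeriv, fun u => ?_⟩
  rw [hint u, ← integral_rnDeriv_smul hac]
  rfl

end Density

/-! ### The Abel–Dini theorem on series -/

section AbelDini

/-- Past an index `N` where the tail is below `1/2`, replacing each partial sum by the last one
gives `(T n - T N) / T n ≤ 1/2`, so `T n ≤ 2 * T N`. -/
theorem summable_of_summable_div {a : ℕ → ℝ} (ha : ∀ k, 0 ≤ a k)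
    (h : Summable fun k => a k * (1 + ∑ j ∈ Finset.range (k + 1), a j)⁻¹) : Summable a := by
  set T : ℕ → ℝ := fun n => 1 + ∑ j ∈ Finset.range n, a j with hT
  have hT1 : ∀ n, 1 ≤ T n := fun n => le_add_of_nonneg_right (Finset.sum_nonneg fun _ _ => ha _)
  have hTm : Monotone T := monotone_nat_of_le_succ fun n => by
    simp only [hT, Finset.sum_range_succ]; linarith [ha n]
  obtain ⟨N, hN⟩ := ((tendsto_sum_nat_add fun k => a k * (T (k + 1))⁻¹).eventually
    (gt_mem_nhds (by norm_num : (0 : ℝ) < 1 / 2))).exists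
  refine summable_of_sum_range_le (c := 2 * T N) ha fun n => ?_
  by_contra! hn
  have hnN : N ≤ n := by
    by_contra! h'
    have := hTm h'.le
    have h2 := hT1 N
    simp only [hT] at this hn h2
    linarith
  obtain ⟨d, rfl⟩ := Nat.exists_eq_add_of_le hnN
  have h1 : T (N + d) - T N = ∑ k ∈ Finset.range d, a (k + N) := by
    simp only [hT, Finset.sum_range_add, add_comm _ N]
    ring
  have h2 : (T (N + d) - T N) * (T (N + d))⁻¹ ≤ 1 / 2 := by
    rw [h1, Finset.sum_mul]
    refine le_trans (Finset.sum_le_sum fun k hk => ?_)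
      ((((summable_nat_add_iff N).2 h).sum_le_tsum (Finset.range d) fun k _ => ?_).trans hN.le)
    · have := hT1 (k + N + 1)
      refine mul_le_mul_of_nonneg_left (inv_anti₀ (by linarith) (hTm ?_)) (ha _)
      have := Finset.mem_range.1 hk
      omega
    · have := hT1 (k + N + 1)
      exact mul_nonneg (ha _) (inv_nonneg.2 (by linarith))
  have h3 := hT1 (N + d)
  rw [← div_eq_mul_inv, div_le_iff₀ (by linarith)] at h2
  simp only [hT] at h2 hn h3
  linarith

/-- The terms are dominated by the telescoping differences of `T n ^ (1 - p) / (p - 1)`, as in the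
integral test for `t ^ (-p)`. -/
theorem summable_div_rpow {a : ℕ → ℝ} (ha : ∀ k, 0 ≤ a k) {p : ℝ} (hp : 1 < p) :
    Summable fun k => a k * ((1 + ∑ j ∈ Finset.range (k + 1), a j) ^ p)⁻¹ := by
  set T : ℕ → ℝ := fun n => 1 + ∑ j ∈ Finset.range n, a j with hT
  have hT1 : ∀ n, 1 ≤ T n := fun n => le_add_of_nonneg_right (Finset.sum_nonneg fun _ _ => ha _)
  have hstep : ∀ n, (p - 1) * (a n * (T (n + 1) ^ p)⁻¹) ≤ T n ^ (1 - p) - T (n + 1) ^ (1 - p) := by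
    intro n
    have h0 : 0 < T n := by linarith [hT1 n]
    have h1 : 0 < T (n + 1) := by linarith [hT1 (n + 1)]
    have ha' : a n = T (n + 1) - T n := by simp only [hT, Finset.sum_range_succ]; ring
    have hx : 0 < T n / T (n + 1) := by positivity
    -- Bernoulli's inequality for a negative exponent, from `exp s ≥ 1 + s` and `log t ≤ t - 1`.
    have h2 : 1 + (p - 1) * (1 - T n / T (n + 1)) ≤ (T n / T (n + 1)) ^ (1 - p) := by
      rw [Real.rpow_def_of_pos hx]
      have h3 := Real.add_one_le_exp (Real.log (T n / T (n + 1)) * (1 - p))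
      have h4 := Real.log_le_sub_one_of_pos hx
      nlinarith
    have h5 : 0 < T (n + 1) ^ (1 - p) := Real.rpow_pos_of_pos h1 _
    have h6 : T n ^ (1 - p) = (T n / T (n + 1)) ^ (1 - p) * T (n + 1) ^ (1 - p) := by
      rw [Real.div_rpow h0.le h1.le, div_mul_cancel₀ _ h5.ne']
    have h7 : (T (n + 1) ^ p)⁻¹ = T (n + 1) ^ (1 - p) / T (n + 1) := by
      rw [Real.rpow_sub h1, Real.rpow_one]
      field_simp
    rw [h6, h7, ha']
    have h8 : (p - 1) * ((T (n + 1) - T n) * (T (n + 1) ^ (1 - p) / T (n + 1))) =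
        (p - 1) * (1 - T n / T (n + 1)) * T (n + 1) ^ (1 - p) := by field_simp
    rw [h8]
    nlinarith
  refine summable_of_sum_range_le (c := (p - 1)⁻¹) (fun k => mul_nonneg (ha k)
    (inv_nonneg.2 (Real.rpow_nonneg (by linarith [hT1 (k + 1)]) _))) fun n => ?_
  rw [← one_div, le_div_iff₀ (by linarith), mul_comm, Finset.mul_sum]
  refine (Finset.sum_le_sum fun k _ => hstep k).trans ?_
  rw [Finset.sum_range_sub']
  have : T 0 = 1 := by simp [hT]
  rw [this, Real.one_rpow]
  linarith [Real.rpow_nonneg (by linarith [hT1 n] : 0 ≤ T n) (1 - p)]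

theorem tsum_ne_top_of_tsum_div_ne_top {a : ℕ → ℝ≥0∞} (ha : ∀ k, a k ≠ ∞)
    (h : ∑' k, a k * (1 + ∑ j ∈ Finset.range (k + 1), a j)⁻¹ ≠ ∞) : ∑' k, a k ≠ ∞ := by
  lift a to ℕ → NNReal using ha
  have h1 : ∀ k, (a k : ℝ≥0∞) * (1 + ∑ j ∈ Finset.range (k + 1), (a j : ℝ≥0∞))⁻¹ =
      ((a k * (1 + ∑ j ∈ Finset.range (k + 1), a j)⁻¹ : NNReal) : ℝ≥0∞) := fun k => by
    rw [ENNReal.coe_mul, ENNReal.coe_inv (by positivity)]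
    push_cast
    rfl
  simp_rw [h1] at h
  rw [ENNReal.tsum_coe_ne_top_iff_summable, ← NNReal.summable_coe] at h ⊢
  exact summable_of_summable_div (fun k => (a k).2) (by simpa using h)

theorem tsum_div_rpow_ne_top {a : ℕ → ℝ≥0∞} (ha : ∀ k, a k ≠ ∞) {p : ℝ} (hp : 1 < p) :
    ∑' k, a k * ((1 + ∑ j ∈ Finset.range (k + 1), a j) ^ p)⁻¹ ≠ ∞ := by
  lift a to ℕ → NNReal using ha
  have h1 : ∀ k, (a k : ℝ≥0∞) * ((1 + ∑ j ∈ Finset.range (k + 1), (a j : ℝ≥0∞)) ^ p)⁻¹ =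
      ((a k * ((1 + ∑ j ∈ Finset.range (k + 1), a j) ^ p)⁻¹ : NNReal) : ℝ≥0∞) := fun k => by
    have : (1 + ∑ j ∈ Finset.range (k + 1), a j) ≠ 0 := by positivity
    rw [ENNReal.coe_mul, ENNReal.coe_inv (by positivity), ENNReal.coe_rpow_of_ne_zero this]
    push_cast
    rfl
  simp_rw [h1]
  rw [ENNReal.tsum_coe_ne_top_iff_summable, ← NNReal.summable_coe]
  simpa using summable_div_rpow (fun k => (a k).2) hp

end AbelDini

/-! ### Conditional Landau theorem by slicing -/

section Slices

variable {Ω : Type*} {m m0 : MeasurableSpace Ω} {P : Measure Ω} [IsProbabilityMeasure P]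

theorem measurable_apply_index {κ : Ω → ℕ} (hκ : Measurable κ) {c : ℕ → Ω → ℝ≥0∞}
    (hc : ∀ k, Measurable (c k)) : Measurable fun ω => c (κ ω) ω :=
  (measurable_from_prod_countable_right hc : Measurable fun x : ℕ × Ω => c x.1 x.2).comp
    (hκ.prodMk measurable_id)

/-- Conditional expectation of a product whose second factor is `m`-measurable on each level set of
an integer-valued index. -/
theorem condLExp_slice (hm : m ≤ m0) {κ : Ω → ℕ} (hκ : Measurable κ) {X : Ω → ℝ≥0∞}
    (hX : Measurable X) {c : ℕ → Ω → ℝ≥0∞} (hc : ∀ k, Measurable[m] (c k)) :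
    P⁻[fun ω => X ω * c (κ ω) ω|m] =ᵐ[P]
      fun ω => ∑' k, c k ω * P⁻[(κ ⁻¹' {k}).indicator X|m] ω := by
  have hind : ∀ k, Measurable ((κ ⁻¹' {k}).indicator X) := fun k =>
    hX.indicator (hκ (measurableSet_singleton k))
  have h1 : (fun ω => X ω * c (κ ω) ω) = ∑' k, fun ω => c k ω * (κ ⁻¹' {k}).indicator X ω := by
    ext ω
    rw [ENNReal.tsum_apply, tsum_eq_single (κ ω)]
    · simp [mul_comm]
    · intro k hk
      rw [Set.indicator_of_notMem (by simpa using hk.symm), mul_zero]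
  rw [h1]
  refine (condLExp_tsum m fun k =>
    (((hc k).mono hm le_rfl).mul (hind k)).aemeasurable).trans ?_
  filter_upwards [ae_all_iff.2 fun k => condLExp_mul_left hm (hc k) (hind k).aemeasurable (P := P)]
    with ω hω
  rw [ENNReal.tsum_apply]
  exact tsum_congr hω

theorem ae_eq_zero_of_condLExp_eq_zero (hm : m ≤ m0) {X : Ω → ℝ≥0∞} (hX : Measurable X) :
    ∀ᵐ ω ∂P, P⁻[X|m] ω = 0 → X ω = 0 := by
  have hs : MeasurableSet[m] {ω | P⁻[X|m] ω = 0} :=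
    measurable_condLExp m P X (measurableSet_singleton 0)
  have h := setLIntegral_condLExp hm P X hs
  rw [setLIntegral_congr_fun (hm _ hs) (fun ω hω => hω), lintegral_zero, eq_comm,
    setLIntegral_eq_zero_iff (hm _ hs) hX] at h
  exact h

theorem index_le {F : ℝ≥0∞} (hF : F ≠ ∞) : (⌊F.toReal⌋₊ : ℝ≥0∞) ≤ F ∧ F ≤ ⌊F.toReal⌋₊ + 1 := by
  lift F to NNReal using hF
  rw [ENNReal.coe_toReal]
  have h1 : ((⌊(F : ℝ)⌋₊ : NNReal) : ℝ) ≤ F := by exact_mod_cast Nat.floor_le F.2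
  have h2 : (F : ℝ) ≤ ((⌊(F : ℝ)⌋₊ : NNReal) : ℝ) + 1 := by
    exact_mod_cast (Nat.lt_floor_add_one (F : ℝ)).le
  exact ⟨by exact_mod_cast h1, by exact_mod_cast h2⟩

/-- Conditional version of Landau's theorem for exponents in `(1, ∞)`. -/
theorem condLExp_rpow_lt_top_of_dual (hm : m ≤ m0) {p q : ℝ} (hp : 1 < p) (hq : 1 ≤ q)
    (hpq : (q - 1) * p = q) {F : Ω → ℝ≥0∞} (hF : Measurable F) (hFt : ∀ ω, F ω ≠ ∞)
    (h : ∀ U : Ω → ℝ≥0∞, Measurable U → (∀ᵐ ω ∂P, P⁻[fun ω => U ω ^ p|m] ω < ∞) →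
      ∀ᵐ ω ∂P, P⁻[fun ω => F ω * U ω|m] ω < ∞) :
    ∀ᵐ ω ∂P, P⁻[fun ω => F ω ^ q|m] ω < ∞ := by
  have hκ : Measurable fun ω => ⌊(F ω).toReal⌋₊ := Nat.measurable_floor.comp hF.ennreal_toReal
  set κ : Ω → ℕ := fun ω => ⌊(F ω).toReal⌋₊ with hκdef
  have hX : Measurable fun ω => F ω ^ q := hF.pow_const q
  -- The conditional `q`-mass of a slice is finite because `F ≤ k + 1` there; the total `∑ a k` is
  -- `P⁻[F ^ q|m]`.
  set a : ℕ → Ω → ℝ≥0∞ := fun k => P⁻[(κ ⁻¹' {k}).indicator fun ω => F ω ^ q|m] with hadef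
  have ha : ∀ k, Measurable[m] (a k) := fun k => measurable_condLExp _ _ _
  have hafin : ∀ᵐ ω ∂P, ∀ k, a k ω ≠ ∞ := by
    refine ae_all_iff.2 fun k => condLExp_ne_top (ne_top_of_le_ne_top
      (b := ∫⁻ _, ((k : ℝ≥0∞) + 1) ^ q ∂P) ?_ (lintegral_mono fun ω => ?_))
    · rw [lintegral_const, measure_univ, mul_one]
      exact (ENNReal.rpow_lt_top_of_nonneg (by linarith) (by simp)).ne
    · refine Set.indicator_apply_le (g := fun _ => ((k : ℝ≥0∞) + 1) ^ q) fun hω => ?_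
      have : κ ω = k := hω
      rw [← this]
      exact ENNReal.rpow_le_rpow (index_le (hFt ω)).2 (by linarith)
  set S : ℕ → Ω → ℝ≥0∞ := fun k ω => 1 + ∑ j ∈ Finset.range (k + 1), a j ω with hSdef
  have hS : ∀ k, Measurable[m] (S k) := fun k =>
    (Finset.measurable_fun_sum _ fun j _ => ha j).const_add 1
  -- With `U = F^{q-1} / S_κ` and `(q - 1) p = q`, the conditional expectation of `U^p` is `∑ a_k /
  -- S_k^p`, always finite, while that of `F U` is `∑ a_k / S_k`, whose finiteness forces `∑ a_k <
  -- ∞`.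
  have hU : Measurable fun ω => F ω ^ (q - 1) * (S (κ ω) ω)⁻¹ :=
    (hF.pow_const _).mul (measurable_apply_index hκ fun k => ((hS k).mono hm le_rfl)).inv
  have h1 := h _ hU (by
    have h2 : (fun ω => (F ω ^ (q - 1) * (S (κ ω) ω)⁻¹) ^ p) =
        fun ω => F ω ^ q * (S (κ ω) ω ^ p)⁻¹ := by
      ext ω
      rw [ENNReal.mul_rpow_of_nonneg _ _ (by linarith), ← ENNReal.rpow_mul, hpq, ENNReal.inv_rpow]
    rw [h2]
    filter_upwards [condLExp_slice (P := P) hm hκ hX (c := fun k ω => (S k ω ^ p)⁻¹)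
      (fun k => ((hS k).pow_const p).inv), hafin] with ω h3 h4
    rw [h3, lt_top_iff_ne_top]
    simpa only [mul_comm] using tsum_div_rpow_ne_top h4 hp)
  have h2 : (fun ω => F ω * (F ω ^ (q - 1) * (S (κ ω) ω)⁻¹)) =
      fun ω => F ω ^ q * (S (κ ω) ω)⁻¹ := by
    ext ω
    rw [← mul_assoc]
    congr 1
    conv_lhs => rw [← ENNReal.rpow_one (F ω), ← ENNReal.rpow_mul, one_mul]
    rw [← ENNReal.rpow_add_of_nonneg _ _ zero_le_one (by linarith)]
    congr 1
    ring
  rw [h2] at h1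
  have h5 := condLExp_slice (P := P) hm hκ hX (c := fun _ _ => 1) fun _ => measurable_const
  simp only [mul_one, one_mul] at h5
  filter_upwards [h1, h5, hafin, condLExp_slice (P := P) hm hκ hX (c := fun k ω => (S k ω)⁻¹)
      (fun k => (hS k).inv)] with ω h6 h7 h8 h9
  rw [h9, lt_top_iff_ne_top] at h6
  rw [h7, lt_top_iff_ne_top]
  exact tsum_ne_top_of_tsum_div_ne_top h8 (by simpa only [mul_comm] using h6)

/-- Conditional version of Landau's theorem for the exponent `1`. -/
theorem exists_le_of_dual_one (hm : m ≤ m0) {F : Ω → ℝ≥0∞} (hF : Measurable F)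
    (hFt : ∀ ω, F ω ≠ ∞)
    (h : ∀ U : Ω → ℝ≥0∞, Measurable U → (∀ᵐ ω ∂P, P⁻[U|m] ω < ∞) →
      ∀ᵐ ω ∂P, P⁻[fun ω => F ω * U ω|m] ω < ∞) :
    ∃ η : Ω → ℝ≥0∞, Measurable[m] η ∧ ∀ᵐ ω ∂P, η ω < ∞ ∧ F ω ≤ η ω := by
  have hκ : Measurable fun ω => ⌊(F ω).toReal⌋₊ := Nat.measurable_floor.comp hF.ennreal_toReal
  set κ : Ω → ℕ := fun ω => ⌊(F ω).toReal⌋₊ with hκdef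
  have hX : Measurable fun _ : Ω => (1 : ℝ≥0∞) := measurable_const
  have hind : ∀ k, Measurable ((κ ⁻¹' {k}).indicator fun _ => (1 : ℝ≥0∞)) := fun k =>
    hX.indicator (hκ (measurableSet_singleton k))
  set a : ℕ → Ω → ℝ≥0∞ := fun k => P⁻[(κ ⁻¹' {k}).indicator fun _ => 1|m] with hadef
  have ha : ∀ k, Measurable[m] (a k) := fun k => measurable_condLExp _ _ _
  have hafin : ∀ᵐ ω ∂P, ∀ k, a k ω ≠ ∞ := by
    refine ae_all_iff.2 fun k => condLExp_ne_top (ne_top_of_le_ne_top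
      (b := ∫⁻ _, 1 ∂P) (by simp) (lintegral_mono fun ω => ?_))
    exact Set.indicator_apply_le fun _ => le_rfl
  -- `b k` marks where slice `k` has positive conditional probability. The goal is that almost
  -- surely only finitely many slices are marked, so that the largest marked index bounds `F`.
  set b : ℕ → Ω → ℝ≥0∞ := fun k => {ω | a k ω = 0}ᶜ.indicator fun _ => 1 with hbdef
  have hb : ∀ k, Measurable[m] (b k) := fun k =>
    measurable_const.indicator (ha k (measurableSet_singleton 0)).compl
  have hb0 : ∀ k ω, a k ω = 0 → b k ω = 0 := fun k ω h0 =>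
    Set.indicator_of_notMem (by simpa using h0) _
  have hb1 : ∀ k ω, a k ω ≠ 0 → b k ω = 1 := fun k ω h0 =>
    Set.indicator_of_mem (by simpa using h0) _
  have hbfin : ∀ k ω, b k ω ≤ 1 := fun k ω => Set.indicator_apply_le fun _ => le_rfl
  have hba : ∀ k ω, a k ω ≠ ∞ → b k ω * (a k ω)⁻¹ * a k ω = b k ω := by
    intro k ω ht
    by_cases h0 : a k ω = 0
    · simp [hb0 k ω h0]
    · rw [mul_assoc, ENNReal.inv_mul_cancel h0 ht, mul_one]
  set S : ℕ → Ω → ℝ≥0∞ := fun k ω => 1 + ∑ j ∈ Finset.range (k + 1), b j ω with hSdef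
  have hS : ∀ k, Measurable[m] (S k) := fun k =>
    (Finset.measurable_fun_sum _ fun j _ => hb j).const_add 1
  have hS2 : ∀ k ω, S k ω ≤ k + 2 := by
    intro k ω
    have := Finset.sum_le_card_nsmul (Finset.range (k + 1)) (fun j => b j ω) 1
      fun j _ => hbfin j ω
    rw [Finset.card_range, nsmul_one, Nat.cast_add, Nat.cast_one] at this
    calc S k ω ≤ 1 + (k + 1) := by simp only [hSdef]; gcongr
      _ = k + 2 := by ring
  have hS0 : ∀ k ω, S k ω ≠ 0 := fun k ω => by simp [hSdef]
  have hSt : ∀ k ω, S k ω ≠ ∞ := fun k ω =>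
    ne_top_of_le_ne_top (by simp [ENNReal.add_eq_top]) (hS2 k ω)
  have hc : ∀ k, Measurable[m] fun ω => b k ω * (a k ω)⁻¹ * (S k ω ^ (2 : ℝ))⁻¹ := fun k =>
    ((hb k).mul (ha k).inv).mul ((hS k).pow_const _).inv
  -- Dividing by `a k` normalises each marked slice to conditional mass one. The test variable then
  -- has conditional expectation `∑ b_k / S_k^2 < ∞`; since `S_κ ≤ κ + 2 ≤ F + 2`, the hypothesis on
  -- `F` also gives `∑ b_k / S_k < ∞`, and Abel–Dini yields `∑ b_k < ∞`.
  set c : ℕ → Ω → ℝ≥0∞ := fun k ω => b k ω * (a k ω)⁻¹ * (S k ω ^ (2 : ℝ))⁻¹ with hcdef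
  have hU : Measurable fun ω => c (κ ω) ω :=
    measurable_apply_index hκ fun k => (hc k).mono hm le_rfl
  have hUfin : ∀ᵐ ω ∂P, P⁻[fun ω => c (κ ω) ω|m] ω < ∞ := by
    have h1 := condLExp_slice (P := P) hm hκ hX hc
    simp only [one_mul] at h1
    filter_upwards [h1, hafin] with ω h2 h3
    rw [h2, lt_top_iff_ne_top]
    convert tsum_div_rpow_ne_top (a := fun k => b k ω)
      (fun k => ne_top_of_le_ne_top ENNReal.one_ne_top (hbfin k ω)) one_lt_two using 3 with k
    refine (mul_right_comm _ _ _).trans ?_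
    rw [show b k ω * (a k ω)⁻¹ * P⁻[(κ ⁻¹' {k}).indicator fun _ => 1|m] ω = b k ω from
      hba k ω (h3 k)]
  have hFU : ∀ᵐ ω ∂P, P⁻[fun ω => S (κ ω) ω * c (κ ω) ω|m] ω < ∞ := by
    refine condLExp_lt_top_of_le (Y := (fun ω => F ω * c (κ ω) ω) + (2 : ℝ≥0∞) •
      fun ω => c (κ ω) ω) (.of_forall fun ω => ?_) ?_
    · simp only [Pi.add_apply, Pi.smul_apply, smul_eq_mul]
      rw [← add_mul]
      gcongr
      refine (hS2 _ _).trans ?_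
      gcongr
      exact (index_le (hFt ω)).1
    · filter_upwards [condLExp_add_left (mΩ := m) (P := P) ((2 : ℝ≥0∞) • fun ω => c (κ ω) ω)
          (hF.mul hU).aemeasurable, condLExp_smul (mΩ := m) _ (hU.aemeasurable (μ := P)) 2,
        h _ hU hUfin, hUfin] with ω h1 h2 h3 h4
      refine lt_of_eq_of_lt h1 (ENNReal.add_lt_top.2 ⟨h3, lt_of_eq_of_lt h2 ?_⟩)
      exact ENNReal.mul_lt_top (by simp) h4
  have hbsum : ∀ᵐ ω ∂P, ∑' k, b k ω ≠ ∞ := by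
    have h1 := condLExp_slice (P := P) hm hκ hX (c := fun k ω => S k ω * c k ω)
      fun k => (hS k).mul (hc k)
    simp only [one_mul] at h1
    filter_upwards [h1, hafin, hFU] with ω h2 h3 h4
    rw [h2, lt_top_iff_ne_top] at h4
    refine tsum_ne_top_of_tsum_div_ne_top
      (fun k => ne_top_of_le_ne_top ENNReal.one_ne_top (hbfin k ω)) ?_
    convert h4 using 3 with k
    have h5 : S k ω * (S k ω ^ (2 : ℝ))⁻¹ = (S k ω)⁻¹ := by
      rw [ENNReal.rpow_two, sq, ENNReal.mul_inv (Or.inl (hS0 k ω)) (Or.inl (hSt k ω)),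
        ← mul_assoc, ENNReal.mul_inv_cancel (hS0 k ω) (hSt k ω), one_mul]
    calc b k ω * (S k ω)⁻¹ = (b k ω * (a k ω)⁻¹ * a k ω) * (S k ω * (S k ω ^ (2 : ℝ))⁻¹) := by
          rw [hba k ω (h3 k), h5]
      _ = S k ω * c k ω * a k ω := by simp only [hcdef]; ring
  refine ⟨fun ω => ∑' k : ℕ, ((k : ℝ≥0∞) + 1) * b k ω,
    ?_, ?_⟩
  · simp_rw [ENNReal.tsum_eq_iSup_sum]
    exact Measurable.iSup fun s => Finset.measurable_fun_sum s fun k _ => (hb k).const_mul _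
  have hnull := ae_all_iff.2 fun k => ae_eq_zero_of_condLExp_eq_zero (P := P) hm (hind k)
  filter_upwards [hbsum, hnull] with ω h1 h2
  constructor
  · have h3 : {k | b k ω ≠ 0}.Finite := by
      have h4 := (ENNReal.tendsto_cofinite_zero_of_tsum_ne_top h1).eventually
        (gt_mem_nhds one_pos)
      refine (Filter.eventually_cofinite.1 h4).subset fun k hk => ?_
      have : a k ω ≠ 0 := fun h0 => hk (hb0 k ω h0)
      simp [hb1 k ω this]
    rw [tsum_eq_sum (s := h3.toFinset) fun k hk => by
      have : b k ω = 0 := by simpa using hk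
      rw [this, mul_zero]]
    refine ENNReal.sum_lt_top.2 fun k _ => ENNReal.mul_lt_top (by simp) ?_
    exact (hbfin k ω).trans_lt ENNReal.one_lt_top
  · have h3 : b (κ ω) ω = 1 := by
      refine hb1 _ _ fun h0 => ?_
      simpa using h2 (κ ω) h0
    calc F ω ≤ ((κ ω : ℝ≥0∞) + 1) * b (κ ω) ω := by
          rw [h3, mul_one]; exact (index_le (hFt ω)).2
      _ ≤ _ := ENNReal.le_tsum (f := fun k : ℕ => ((k : ℝ≥0∞) + 1) * b k ω) (κ ω)

end Slices

/-! ### The subgradient density and its integrability -/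

section Subgradient

variable {Ω : Type*} {m m0 : MeasurableSpace Ω} {P : Measure Ω} {r : ℝ}
  {R : (Ω → ℝ) → Ω → ℝ} {x : Ω → ℝ}

theorem IsRiskFunctional.aestronglyMeasurable_sub (hR : IsRiskFunctional m P r R) (hr : 1 ≤ r)
    (hx : MemLpF m P r x) {u : Ω → ℝ} (hu : MemLpF m P r u) :
    AEStronglyMeasurable[m] (fun ω => R (fun ω => x ω + u ω) ω - R x ω) P :=
  (hR.meas _ (hx.add hr hu)).sub (hR.meas _ hx)

theorem mul_mem_boundedMeasurable (hm : m ≤ m0) {η u : Ω → ℝ} (hη : Measurable[m] η)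
    (h0 : ∀ ω, 0 ≤ η ω) (h1 : ∀ ω, η ω ≤ 1) (hu : u ∈ boundedMeasurable Ω) :
    (fun ω => η ω * u ω) ∈ boundedMeasurable Ω := by
  obtain ⟨hu, C, hC⟩ := hu
  refine ⟨(hη.mono hm le_rfl).mul hu, C, fun ω => ?_⟩
  rw [abs_mul, abs_of_nonneg (h0 ω)]
  exact (mul_le_of_le_one_left (abs_nonneg _) (h1 ω)).trans (hC ω)

theorem indicator_one_weight {A : Set Ω} (hA : MeasurableSet[m] A) :
    Measurable[m] (A.indicator fun _ => (1 : ℝ)) ∧ (∀ ω, 0 ≤ A.indicator (fun _ => (1 : ℝ)) ω) ∧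
      ∀ ω, A.indicator (fun _ => (1 : ℝ)) ω ≤ 1 :=
  ⟨measurable_const.indicator hA, fun ω => Set.indicator_nonneg (fun _ _ => zero_le_one) ω,
    fun _ => Set.indicator_apply_le' (fun _ => le_rfl) fun _ => zero_le_one⟩

theorem integral_indicator_one_mul (hm : m ≤ m0) {A : Set Ω} (hA : MeasurableSet[m] A)
    (k : Ω → ℝ) : ∫ ω, A.indicator (fun _ => (1 : ℝ)) ω * k ω ∂P = ∫ ω in A, k ω ∂P := by
  rw [← integral_indicator (hm A hA)]
  congr with ω
  by_cases h : ω ∈ A <;> simp [h]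

variable [IsProbabilityMeasure P]

theorem memLpF_of_mem_boundedMeasurable (hm : m ≤ m0) (hr : 1 ≤ r) {u : Ω → ℝ}
    (hu : u ∈ boundedMeasurable Ω) : MemLpF m P r u := by
  obtain ⟨hu, C, hC⟩ := hu
  exact .of_bounded hm (by linarith) hu.aestronglyMeasurable (.of_forall hC)

/-- Taking the constant `C` as the dominating direction, cash invariance evaluates the bound
exactly. -/
theorem IsRiskFunctional.abs_sub_le_const (hm : m ≤ m0) (hR : IsRiskFunctional m P r R)
    (hr : 1 ≤ r) (hx : MemLpF m P r x) {u : Ω → ℝ} (hu : MemLpF m P r u) {C : ℝ}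
    (hC : ∀ ω, |u ω| ≤ C) : ∀ᵐ ω ∂P, |R (fun ω => x ω + u ω) ω - R x ω| ≤ C := by
  have hw : MemLpF m P r fun _ => C := memLpF_of_measurable hm (by linarith) measurable_const
  filter_upwards [hR.abs_sub_le hr hx hu hw (.of_forall hC),
    hR.cash_invariant x (fun _ => -C) hx measurable_const] with ω h1 h2
  simp only [← sub_eq_add_neg] at h2
  rw [h2] at h1
  linarith

theorem IsRiskFunctional.integrable_sub (hm : m ≤ m0) (hR : IsRiskFunctional m P r R) (hr : 1 ≤ r)
    (hx : MemLpF m P r x) {u : Ω → ℝ} (hu : u ∈ boundedMeasurable Ω) :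
    Integrable (fun ω => R (fun ω => x ω + u ω) ω - R x ω) P := by
  have hu' := memLpF_of_mem_boundedMeasurable (m := m) (P := P) hm hr hu
  obtain ⟨-, C, hC⟩ := hu
  exact (integrable_const C).mono' ((hR.aestronglyMeasurable_sub hr hx hu').mono hm)
    (hR.abs_sub_le_const hm hr hx hu' hC)

theorem IsRiskFunctional.tendsto_integral_sub (hm : m ≤ m0) (hR : IsRiskFunctional m P r R)
    (hr : 1 ≤ r) (hx : MemLpF m P r x) (w : ℕ → boundedMeasurable Ω) {C : ℝ}
    (hC : ∀ n ω, |(w n).1 ω| ≤ C) (hw : ∀ ω, Tendsto (fun n => (w n).1 ω) atTop (𝓝 0)) :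
    Tendsto (fun n => ∫ ω, R (fun ω => x ω + (w n).1 ω) ω - R x ω ∂P) atTop (𝓝 0) := by
  have hr0 : 0 ≤ r := by linarith
  have hwL : ∀ n, MemLpF m P r (w n).1 := fun n =>
    memLpF_of_mem_boundedMeasurable hm hr (w n).2
  have hlim := hR.tendsto hm hr (v := fun n ω => x ω + (w n).1 ω) (y := fun ω => |x ω| + C)
    (fun n => hx.add hr (hwL n)) hx
    ((hx.abs hr0).add hr (memLpF_of_measurable hm hr0 measurable_const))
    (fun n => .of_forall fun ω => (abs_add_le _ _).trans (add_le_add_right (hC n ω) _))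
    (.of_forall fun ω => by simpa using (hw ω).const_add (x ω))
  have := tendsto_integral_of_dominated_convergence (μ := P)
    (F := fun n ω => R (fun ω => x ω + (w n).1 ω) ω - R x ω) (f := fun _ => 0) (fun _ => C)
    (fun n => (hR.aestronglyMeasurable_sub hr hx (hwL n)).mono hm) (integrable_const C)
    (fun n => hR.abs_sub_le_const hm hr hx (hwL n) (hC n))
    (hlim.mono fun ω h => by simpa using h.sub_const (R x ω))
  simpa using this

/-- An integrated subgradient of a risk functional with respect to bounded directions. -/
theorem IsRiskFunctional.exists_integral_subgradient (hm : m ≤ m0)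
    (hR : IsRiskFunctional m P r R) (hr : 1 ≤ r) (hx : MemLpF m P r x) :
    ∃ f : Ω → ℝ, Measurable f ∧ (∀ ω, 0 ≤ f ω) ∧ Integrable f P ∧
      ∀ u ∈ boundedMeasurable Ω,
        -∫ ω, f ω * u ω ∂P ≤ ∫ ω, R (fun ω => x ω + u ω) ω - R x ω ∂P := by
  let φ : boundedMeasurable Ω → ℝ := fun u => ∫ ω, R (fun ω => x ω + u.1 ω) ω - R x ω ∂P
  have hL : ∀ u : boundedMeasurable Ω, MemLpF m P r u.1 := fun u =>
    memLpF_of_mem_boundedMeasurable hm hr u.2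
  have hint : ∀ u : boundedMeasurable Ω,
      Integrable (fun ω => R (fun ω => x ω + u.1 ω) ω - R x ω) P :=
    fun u => hR.integrable_sub hm hr hx u.2
  have hnull : ∀ u : boundedMeasurable Ω, u.1 =ᵐ[P] 0 → φ u = 0 := by
    intro u hu
    refine integral_eq_zero_of_ae ?_
    filter_upwards [hR.congr (fun ω => x ω + u.1 ω) x (hu.mono fun ω h => by simp [h])] with ω h
    simp [h]
  have hconv : ConvexOn ℝ Set.univ φ := by
    refine ⟨convex_univ, fun u _ v _ a b ha hb hab => ?_⟩
    obtain rfl : b = 1 - a := by linarith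
    simp only [φ, smul_eq_mul]
    rw [← integral_const_mul, ← integral_const_mul, ← integral_add ((hint u).const_mul _)
      ((hint v).const_mul _)]
    refine integral_mono_ae (hint _) (((hint u).const_mul _).add ((hint v).const_mul _)) ?_
    filter_upwards [hR.convex (fun _ => a) measurable_const (fun _ => ha) (fun _ => by linarith)
      _ _ (hx.add hr (hL u)) (hx.add hr (hL v))] with ω h
    have he : (fun ω => a * (x ω + u.1 ω) + (1 - a) * (x ω + v.1 ω)) =
        fun ω => x ω + (a • u + (1 - a) • v).1 ω := by
      ext ω
      simp only [Submodule.coe_add, Submodule.coe_smul, Pi.add_apply, Pi.smul_apply, smul_eq_mul]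
      ring
    rw [he] at h
    linarith
  obtain ⟨l, hl⟩ := exists_linearMap_le_of_convexOn hconv (hnull 0 (by rfl))
  have hpos : ∀ u : boundedMeasurable Ω, (∀ ω, 0 ≤ u.1 ω) → 0 ≤ (-l) u := by
    intro u hu
    have h1 : φ u ≤ 0 := by
      refine integral_nonpos_of_ae ?_
      filter_upwards [hR.antitone x _ hx (hx.add hr (hL u))
        (.of_forall fun ω => le_add_of_nonneg_right (hu ω))] with ω h
      simpa using h
    simpa using (hl u).trans h1
  have hzero : ∀ u : boundedMeasurable Ω, u.1 =ᵐ[P] 0 → (-l) u = 0 := by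
    intro u hu
    have h1 := (hl u).trans (hnull u hu).le
    have h2 := (hl (-u)).trans (hnull (-u) (hu.mono fun ω h => by simpa using h)).le
    rw [map_neg] at h2
    simp only [LinearMap.neg_apply]
    linarith
  have hcont : ∀ (u : ℕ → boundedMeasurable Ω) (v : boundedMeasurable Ω) (C : ℝ),
      (∀ n ω, |(u n).1 ω| ≤ C) → (∀ ω, Tendsto (fun n => (u n).1 ω) atTop (𝓝 (v.1 ω))) →
      Tendsto (fun n => (-l) (u n)) atTop (𝓝 ((-l) v)) := by
    intro u v C hC hlim
    have hvC : ∀ ω, |v.1 ω| ≤ C := fun ω =>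
      le_of_tendsto (hlim ω).abs (.of_forall fun n => hC n ω)
    -- Only `l ≤ φ` is known, so `l (u n) - l v` is squeezed between `-φ (v - u n)` and `φ (u n -
    -- v)`.
    have h1 := hR.tendsto_integral_sub hm hr hx (fun n => u n - v) (C := C + C)
      (fun n ω => (abs_sub _ _).trans (add_le_add (hC n ω) (hvC ω)))
      (fun ω => by simpa using (hlim ω).sub_const (v.1 ω))
    have h2 := hR.tendsto_integral_sub hm hr hx (fun n => v - u n) (C := C + C)
      (fun n ω => (abs_sub _ _).trans (add_le_add (hvC ω) (hC n ω)))
      (fun ω => by simpa using (hlim ω).const_sub (v.1 ω))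
    have h2' := h2.neg
    rw [neg_zero] at h2'
    have h3 : Tendsto (fun n => l (u n) - l v) atTop (𝓝 0) := by
      refine tendsto_of_tendsto_of_tendsto_of_le_of_le h2' h1 (fun n => ?_)
        fun n => ?_
      · have := hl (v - u n)
        rw [map_sub] at this
        simp only [φ] at this
        dsimp only
        linarith
      · have := hl (u n - v)
        rwa [map_sub] at this
    have h4 := (h3.add_const (l v)).neg
    simpa using h4
  obtain ⟨f, hf, hf0, hfi, hfl⟩ := exists_density (P := P) (-l) hpos hzero hcont
  refine ⟨f, hf, hf0, hfi, fun u hu => ?_⟩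
  rw [← hfl ⟨u, hu⟩]
  simpa using hl ⟨u, hu⟩

/-- The subgradient inequality with a conditional weight, for bounded directions. -/
theorem IsRiskFunctional.weighted_subgradient (hm : m ≤ m0)
    (hR : IsRiskFunctional m P r R) (hr : 1 ≤ r) (hx : MemLpF m P r x) {f : Ω → ℝ}
    (hf : ∀ u ∈ boundedMeasurable Ω,
        -∫ ω, f ω * u ω ∂P ≤ ∫ ω, R (fun ω => x ω + u ω) ω - R x ω ∂P)
    {η u : Ω → ℝ} (hη : Measurable[m] η) (h0 : ∀ ω, 0 ≤ η ω) (h1 : ∀ ω, η ω ≤ 1)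
    (hu : u ∈ boundedMeasurable Ω) :
    -∫ ω, f ω * (η ω * u ω) ∂P ≤ ∫ ω, η ω * (R (fun ω => x ω + u ω) ω - R x ω) ∂P := by
  have hηu := mul_mem_boundedMeasurable hm hη h0 h1 hu
  refine (hf _ hηu).trans (integral_mono_ae (hR.integrable_sub hm hr hx hηu) ?_ ?_)
  · refine (hR.integrable_sub hm hr hx hu).mono
      ((hη.mono hm le_rfl).aestronglyMeasurable.mul
        (hR.integrable_sub hm hr hx hu).aestronglyMeasurable) (.of_forall fun ω => ?_)
    rw [norm_mul, Real.norm_of_nonneg (h0 ω)]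
    exact mul_le_of_le_one_left (norm_nonneg _) (h1 ω)
  · exact hR.sub_convex hr hx (memLpF_of_mem_boundedMeasurable hm hr hu) hη h0 h1

theorem IsRiskFunctional.condLExp_density (hm : m ≤ m0)
    (hR : IsRiskFunctional m P r R) (hr : 1 ≤ r) (hx : MemLpF m P r x) {f : Ω → ℝ}
    (hf0 : ∀ ω, 0 ≤ f ω) (hfi : Integrable f P)
    (hf : ∀ u ∈ boundedMeasurable Ω,
        -∫ ω, f ω * u ω ∂P ≤ ∫ ω, R (fun ω => x ω + u ω) ω - R x ω ∂P) :
    ∀ᵐ ω ∂P, P⁻[fun ω => ENNReal.ofReal (f ω)|m] ω = 1 := by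
  have hc : ∀ c : ℝ, (fun _ : Ω => c) ∈ boundedMeasurable Ω := fun c =>
    ⟨measurable_const, |c|, fun _ => le_rfl⟩
  -- By cash invariance a constant direction gives an exact right side; the signs `c = 1` and `c =
  -- -1` together force `∫_A f = P(A)`.
  have key : ∀ A, MeasurableSet[m] A → ∀ c : ℝ, -c * ∫ ω in A, f ω ∂P ≤ -c * P.real A := by
    intro A hA c
    obtain ⟨h1, h2, h3⟩ := indicator_one_weight (m := m) hA
    have h4 := hR.weighted_subgradient hm hr hx hf h1 h2 h3 (hc c)
    have h5 : ∀ ω, f ω * (A.indicator (fun _ => (1 : ℝ)) ω * c) =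
        A.indicator (fun _ => (1 : ℝ)) ω * (c * f ω) := fun ω => by ring
    simp_rw [h5] at h4
    rw [integral_indicator_one_mul hm hA, integral_indicator_one_mul hm hA, integral_const_mul] at h4
    have h6 : ∫ ω in A, R (fun ω => x ω + c) ω - R x ω ∂P = -c * P.real A := by
      rw [integral_congr_ae (g := fun _ => -c), setIntegral_const, smul_eq_mul, mul_comm]
      filter_upwards [ae_restrict_of_ae (hR.cash_invariant x (fun _ => c) hx measurable_const)]
        with ω h
      rw [h]; ring
    rw [h6] at h4
    linarith
  have h := ae_eq_condLExp (Y := fun _ => (1 : ℝ≥0∞)) hm P (fun ω => ENNReal.ofReal (f ω))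
    measurable_const fun A hA => by
      rw [← ofReal_integral_eq_lintegral_ofReal hfi.integrableOn (.of_forall hf0)]
      have : ∫ ω in A, f ω ∂P = P.real A := by
        have h1 := key A hA 1
        have h2 := key A hA (-1)
        linarith
      rw [this, setLIntegral_const, one_mul, measureReal_def,
        ENNReal.ofReal_toReal (measure_ne_top _ _)]
  filter_upwards [h] with ω h using h.symm

/-- Testing with `-min(|u|, n)` on sets of `m` and letting `n` grow bounds `P⁻[f|u| | m]` by the
`m`-measurable real variable `R(x - |u|) - R(x)`. The latter need not be integrable, so the
comparison is between integrals in `[0, ∞]`. -/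
theorem IsRiskFunctional.condLExp_mul_lt_top (hm : m ≤ m0)
    (hR : IsRiskFunctional m P r R) (hr : 1 ≤ r) (hx : MemLpF m P r x) {f : Ω → ℝ}
    (hfm : Measurable f) (hf0 : ∀ ω, 0 ≤ f ω) (hfi : Integrable f P)
    (hf : ∀ u ∈ boundedMeasurable Ω,
        -∫ ω, f ω * u ω ∂P ≤ ∫ ω, R (fun ω => x ω + u ω) ω - R x ω ∂P)
    {u : Ω → ℝ} (hu : Measurable u) (huL : MemLpF m P r u) :
    ∀ᵐ ω ∂P, P⁻[fun ω => ‖f ω * u ω‖ₑ|m] ω < ∞ := by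
  have hr0 : 0 ≤ r := by linarith
  let w : ℕ → Ω → ℝ := fun n ω => min |u ω| n
  have hw0 : ∀ n ω, 0 ≤ w n ω := fun n ω => le_min (abs_nonneg _) n.cast_nonneg
  have hwm : ∀ n, Measurable (w n) := fun n => hu.abs.min measurable_const
  have hwB : ∀ n, (fun ω => -w n ω) ∈ boundedMeasurable Ω := fun n =>
    ⟨(hwm n).neg, n, fun ω => by rw [abs_neg, abs_of_nonneg (hw0 n ω)]; exact min_le_right _ _⟩
  have hH := hR.aestronglyMeasurable_sub hr hx ((huL.abs hr0).neg hr0)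
  set H := hH.mk _ with hHdef
  have hHm : Measurable[m] H := hH.stronglyMeasurable_mk.measurable
  have hle : ∀ n A, MeasurableSet[m] A →
      ∫⁻ ω in A, ENNReal.ofReal (f ω * w n ω) ∂P ≤ ∫⁻ ω in A, ENNReal.ofReal (H ω) ∂P := by
    intro n A hA
    obtain ⟨h1, h2, h3⟩ := indicator_one_weight (m := m) hA
    have h4 := hR.weighted_subgradient hm hr hx hf h1 h2 h3 (hwB n)
    have h5 : ∀ ω, f ω * (A.indicator (fun _ => (1 : ℝ)) ω * -w n ω) =
        -(A.indicator (fun _ => (1 : ℝ)) ω * (f ω * w n ω)) := fun ω => by ring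
    simp_rw [h5] at h4
    rw [integral_neg, neg_neg, integral_indicator_one_mul hm hA,
      integral_indicator_one_mul hm hA] at h4
    have h6 : Integrable (fun ω => f ω * w n ω) P := by
      refine (hfi.mul_const (n : ℝ)).mono' (hfm.mul (hwm n)).aestronglyMeasurable
        (.of_forall fun ω => ?_)
      rw [Real.norm_of_nonneg (mul_nonneg (hf0 ω) (hw0 n ω))]
      exact mul_le_mul_of_nonneg_left (min_le_right _ _) (hf0 ω)
    rw [← ofReal_integral_eq_lintegral_ofReal h6.integrableOn
      (.of_forall fun ω => mul_nonneg (hf0 ω) (hw0 n ω))]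
    have hL := memLpF_of_mem_boundedMeasurable (m := m) (P := P) hm hr (hwB n)
    have h7 : ∀ᵐ ω ∂P, 0 ≤ R (fun ω => x ω + -w n ω) ω - R x ω := by
      filter_upwards [hR.antitone _ x (hx.add hr hL) hx
        (.of_forall fun ω => by simpa using hw0 n ω)] with ω h
      exact sub_nonneg.2 h
    refine (ENNReal.ofReal_le_ofReal h4).trans ?_
    rw [ofReal_integral_eq_lintegral_ofReal (hR.integrable_sub hm hr hx (hwB n)).integrableOn
      (ae_restrict_of_ae h7)]
    refine lintegral_mono_ae (ae_restrict_of_ae ?_)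
    filter_upwards [hH.ae_eq_mk, hR.antitone _ _ (hx.add hr ((huL.abs hr0).neg hr0))
      (hx.add hr hL) (.of_forall fun ω => add_le_add_right
        (neg_le_neg (min_le_left |u ω| (n : ℝ))) (x ω))] with ω h8 h9
    rw [hHdef, ← h8]
    exact ENNReal.ofReal_le_ofReal (sub_le_sub_right h9 _)
  have hlim : ∀ A, MeasurableSet[m] A →
      ∫⁻ ω in A, ‖f ω * u ω‖ₑ ∂P ≤ ∫⁻ ω in A, ENNReal.ofReal (H ω) ∂P := by
    intro A hA
    have h1 : ∀ ω, ‖f ω * u ω‖ₑ = ⨆ n, ENNReal.ofReal (f ω * w n ω) := by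
      intro ω
      rw [Real.enorm_eq_ofReal_abs, abs_mul, abs_of_nonneg (hf0 ω)]
      refine le_antisymm ?_ (iSup_le fun n => ENNReal.ofReal_le_ofReal
        (mul_le_mul_of_nonneg_left (min_le_left _ _) (hf0 ω)))
      obtain ⟨n, hn⟩ := exists_nat_ge |u ω|
      refine le_iSup_of_le n ?_
      simp only [w]
      rw [min_eq_left hn]
    simp_rw [h1]
    have h2 : ∀ n, Measurable fun ω => ENNReal.ofReal (f ω * w n ω) := fun n =>
      (hfm.mul (hwm n)).ennreal_ofReal
    rw [lintegral_iSup h2]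
    · exact iSup_le fun n => hle n A hA
    · intro i j hij ω
      exact ENNReal.ofReal_le_ofReal (mul_le_mul_of_nonneg_left
        (min_le_min le_rfl (by exact_mod_cast hij)) (hf0 ω))
  filter_upwards [condLExp_le_of_setLIntegral_le hm hHm.ennreal_ofReal.aemeasurable hlim] with ω h
  exact h.trans_lt ENNReal.ofReal_lt_top

/-- The subgradient inequality with a conditional weight, for directions in `L^r_𝓕(𝓔)`. -/
theorem IsRiskFunctional.weighted_subgradient_of_memLpF (hm : m ≤ m0)
    (hR : IsRiskFunctional m P r R) (hr : 1 ≤ r) (hx : MemLpF m P r x) {f : Ω → ℝ}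
    (hfm : Measurable f)
    (hf : ∀ u ∈ boundedMeasurable Ω,
        -∫ ω, f ω * u ω ∂P ≤ ∫ ω, R (fun ω => x ω + u ω) ω - R x ω ∂P)
    {η u : Ω → ℝ} (hη : Measurable[m] η) (h0 : ∀ ω, 0 ≤ η ω) (h1 : ∀ ω, η ω ≤ 1)
    (hu : Measurable u) (huL : MemLpF m P r u)
    (hint : Integrable (fun ω => f ω * (η ω * u ω)) P)
    (hint' : Integrable (fun ω => η ω * (R (fun ω => x ω - |u ω|) ω - R x ω)) P) :
    -∫ ω, f ω * (η ω * u ω) ∂P ≤ ∫ ω, η ω * (R (fun ω => x ω + u ω) ω - R x ω) ∂P := by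
  have hr0 : 0 ≤ r := by linarith
  have hηm : Measurable η := hη.mono hm le_rfl
  -- Truncation at levels `±n` stays bounded by `|u|`: the left sides converge by dominated
  -- convergence, the right sides by the Lebesgue property with majorant `hint'`.
  let v : ℕ → Ω → ℝ := fun n ω => max (-n) (min (u ω) n)
  have hvm : ∀ n, Measurable (v n) := fun n => measurable_const.max (hu.min measurable_const)
  have hvB : ∀ n, v n ∈ boundedMeasurable Ω := fun n => ⟨hvm n, n, fun ω => abs_le.2
    ⟨le_max_left _ _, max_le (by linarith [n.cast_nonneg (α := ℝ)]) (min_le_right _ _)⟩⟩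
  have hvu : ∀ n ω, |v n ω| ≤ |u ω| := by
    intro n ω
    have hn := n.cast_nonneg (α := ℝ)
    simp only [v]
    rcases max_cases (-(n : ℝ)) (min (u ω) n) with h | h <;>
    rcases min_cases (u ω) (n : ℝ) with h' | h' <;> rw [h.1] <;> grind
  have hvlim : ∀ ω, Tendsto (fun n => v n ω) atTop (𝓝 (u ω)) := by
    intro ω
    obtain ⟨N, hN⟩ := exists_nat_ge |u ω|
    refine tendsto_const_nhds.congr' ?_
    filter_upwards [eventually_ge_atTop N] with n hn
    have h2 : |u ω| ≤ n := hN.trans (by exact_mod_cast hn)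
    rw [abs_le] at h2
    simp only [v]
    rw [min_eq_left h2.2, max_eq_right h2.1]
  have hvL : ∀ n, MemLpF m P r (v n) := fun n =>
    memLpF_of_mem_boundedMeasurable hm hr (hvB n)
  have hRlim := hR.tendsto hm hr (v := fun n ω => x ω + v n ω) (y := fun ω => |x ω| + |u ω|)
    (fun n => hx.add hr (hvL n)) (hx.add hr huL) ((hx.abs hr0).add hr (huL.abs hr0))
    (fun n => .of_forall fun ω => (abs_add_le _ _).trans (add_le_add_right (hvu n ω) _))
    (.of_forall fun ω => (hvlim ω).const_add (x ω))
  have hl := tendsto_integral_of_dominated_convergence (μ := P)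
    (F := fun n ω => f ω * (η ω * v n ω)) (f := fun ω => f ω * (η ω * u ω))
    (fun ω => ‖f ω * (η ω * u ω)‖)
    (fun n => (hfm.mul (hηm.mul (hvm n))).aestronglyMeasurable) hint.norm
    (fun n => .of_forall fun ω => by
      simp only [norm_mul]
      gcongr
      exact hvu n ω)
    (.of_forall fun ω => ((hvlim ω).const_mul _).const_mul _)
  have hrr := tendsto_integral_of_dominated_convergence (μ := P)
    (F := fun n ω => η ω * (R (fun ω => x ω + v n ω) ω - R x ω))
    (f := fun ω => η ω * (R (fun ω => x ω + u ω) ω - R x ω))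
    (fun ω => η ω * (R (fun ω => x ω - |u ω|) ω - R x ω))
    (fun n => hηm.aestronglyMeasurable.mul
      ((hR.aestronglyMeasurable_sub hr hx (hvL n)).mono hm)) hint'
    (fun n => by
      filter_upwards [hR.abs_sub_le hr hx (hvL n) (huL.abs hr0) (.of_forall (hvu n))] with ω h
      rw [norm_mul, Real.norm_of_nonneg (h0 ω)]
      exact mul_le_mul_of_nonneg_left h (h0 ω))
    (hRlim.mono fun ω h => (h.sub_const _).const_mul _)
  exact le_of_tendsto_of_tendsto' hl.neg hrr fun n =>
    hR.weighted_subgradient hm hr hx hf hη h0 h1 (hvB n)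

end Subgradient

/-! ### The conditional subgradient inequality -/

section RealCondExp

variable {Ω : Type*} {m m0 : MeasurableSpace Ω} {P : Measure Ω}

/-- The difference of the finite parts of the conditional expectations of the positive and the
negative part. -/
noncomputable def realCondExp (m : MeasurableSpace Ω) {m0 : MeasurableSpace Ω} (P : Measure Ω)
    (w : Ω → ℝ) : Ω → ℝ := fun ω =>
  (P⁻[fun ω' => ENNReal.ofReal (w ω')|m] ω).toReal -
    (P⁻[fun ω' => ENNReal.ofReal (-w ω')|m] ω).toReal

theorem measurable_realCondExp (w : Ω → ℝ) : Measurable[m] (realCondExp m P w) :=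
  (measurable_condLExp _ _ _).ennreal_toReal.sub (measurable_condLExp _ _ _).ennreal_toReal

/-- Both parts have finite conditional expectation, so the subtraction in `EReal` is the real one.
-/
theorem extCondExp_eq_realCondExp {w : Ω →ₘ[P] ℝ} {v : Ω → ℝ} (hwv : w =ᵐ[P] v)
    (h : ∀ᵐ ω ∂P, P⁻[fun ω => ‖v ω‖ₑ|m] ω < ∞) :
    ∀ᵐ ω ∂P, extCondExp m P w ω = (realCondExp m P v ω : EReal) := by
  have h1 : ∀ ω, ENNReal.ofReal (v ω) ≤ ‖v ω‖ₑ := fun ω => Real.ofReal_le_enorm _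
  have h2 : ∀ ω, ENNReal.ofReal (-v ω) ≤ ‖v ω‖ₑ := fun ω => by
    simpa using Real.ofReal_le_enorm (-v ω)
  filter_upwards [condLExp_lt_top_of_le (.of_forall h1) h, condLExp_lt_top_of_le (.of_forall h2) h,
    condLExp_congr_ae (mΩ := m) (hwv.fun_comp fun t => ENNReal.ofReal t),
    condLExp_congr_ae (mΩ := m) (hwv.fun_comp fun t => ENNReal.ofReal (-t))] with ω h3 h4 h5 h6
  simp only [Function.comp_def] at h5 h6
  rw [extCondExp, h5, h6, realCondExp, EReal.coe_sub, EReal.coe_ennreal_toReal h3.ne,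
    EReal.coe_ennreal_toReal h4.ne]

theorem ae_le_of_forall_setIntegral_le_of_le [IsFiniteMeasure P] (hm : m ≤ m0) {F G : Ω → ℝ} (hF : Measurable[m] F)
    (hG : Measurable[m] G) (hFi : Integrable F P) (hGi : Integrable G P)
    (h : ∀ A, MeasurableSet[m] A → ∫ ω in A, F ω ∂P ≤ ∫ ω in A, G ω ∂P) : F ≤ᵐ[P] G := by
  refine ae_le_of_ae_le_trim (hm := hm) (ae_le_of_forall_setIntegral_le
    (hFi.trim hm hF.stronglyMeasurable) (hGi.trim hm hG.stronglyMeasurable) fun A hA _ => ?_)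
  rw [← setIntegral_trim hm hF.stronglyMeasurable hA, ← setIntegral_trim hm hG.stronglyMeasurable hA]
  exact h A hA

variable [IsProbabilityMeasure P]

theorem integrable_weight_toReal_condLExp (hm : m ≤ m0) {X : Ω → ℝ≥0∞} (hX : Measurable X)
    {g : Ω → ℝ} (hg : Measurable[m] g) (hg0 : ∀ ω, 0 < g ω)
    (hgX : ∫⁻ ω, ENNReal.ofReal (g ω) * X ω ∂P < ∞) :
    Integrable (fun ω => g ω * (P⁻[X|m] ω).toReal) P ∧ ∀ A, MeasurableSet[m] A →
      ∫ ω in A, g ω * (P⁻[X|m] ω).toReal ∂P =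
        (∫⁻ ω in A, ENNReal.ofReal (g ω) * X ω ∂P).toReal := by
  have h1 := condLExp_mul_left (P := P) hm hg.ennreal_ofReal hX.aemeasurable
  have h2 : ∀ ω, g ω * (P⁻[X|m] ω).toReal = (ENNReal.ofReal (g ω) * P⁻[X|m] ω).toReal := fun ω => by
    rw [ENNReal.toReal_mul, ENNReal.toReal_ofReal (hg0 ω).le]
  have hmeas : Measurable fun ω => ENNReal.ofReal (g ω) * P⁻[X|m] ω :=
    (hg.mono hm le_rfl).ennreal_ofReal.mul (measurable_condLExp' _ _ _)
  have hset : ∀ A, MeasurableSet[m] A → ∫⁻ ω in A, ENNReal.ofReal (g ω) * P⁻[X|m] ω ∂P =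
      ∫⁻ ω in A, ENNReal.ofReal (g ω) * X ω ∂P := fun A hA => by
    rw [← setLIntegral_condLExp hm P (fun ω => ENNReal.ofReal (g ω) * X ω) hA]
    exact lintegral_congr_ae (ae_restrict_of_ae h1.symm)
  have hfin : ∫⁻ ω, ENNReal.ofReal (g ω) * P⁻[X|m] ω ∂P ≠ ∞ := by
    rw [← setLIntegral_univ, hset _ .univ, setLIntegral_univ]
    exact hgX.ne
  simp_rw [h2]
  refine ⟨integrable_toReal_of_lintegral_ne_top hmeas.aemeasurable hfin, fun A hA => ?_⟩
  rw [integral_toReal hmeas.aemeasurable (ae_restrict_of_ae (ae_lt_top hmeas hfin)), hset A hA]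

theorem setIntegral_weight_realCondExp (hm : m ≤ m0) {w : Ω → ℝ} (hw : Measurable w)
    {g : Ω → ℝ} (hg : Measurable[m] g) (hg0 : ∀ ω, 0 < g ω)
    (hgw : Integrable (fun ω => g ω * w ω) P) :
    Integrable (fun ω => g ω * realCondExp m P w ω) P ∧ ∀ A, MeasurableSet[m] A →
      ∫ ω in A, g ω * realCondExp m P w ω ∂P = ∫ ω in A, g ω * w ω ∂P := by
  have h1 : ∀ ω, ENNReal.ofReal (g ω) * ENNReal.ofReal (w ω) = ENNReal.ofReal (g ω * w ω) :=
    fun ω => (ENNReal.ofReal_mul (hg0 ω).le).symm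
  have h2 : ∀ ω, ENNReal.ofReal (g ω) * ENNReal.ofReal (-w ω) = ENNReal.ofReal (-(g ω * w ω)) :=
    fun ω => by rw [← ENNReal.ofReal_mul (hg0 ω).le, mul_neg]
  obtain ⟨i1, e1⟩ := integrable_weight_toReal_condLExp (P := P) hm hw.ennreal_ofReal hg hg0 (by
    simp_rw [h1]
    exact (lintegral_mono fun ω => Real.ofReal_le_enorm _).trans_lt hgw.hasFiniteIntegral)
  obtain ⟨i2, e2⟩ := integrable_weight_toReal_condLExp (P := P) hm hw.neg.ennreal_ofReal hg hg0 (by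
    simp only [Pi.neg_apply]
    simp_rw [h2]
    exact (lintegral_mono fun ω => Real.ofReal_le_enorm _).trans_lt hgw.neg.hasFiniteIntegral)
  simp only [Pi.neg_apply] at i2 e2
  have h3 : ∀ ω, g ω * realCondExp m P w ω =
      g ω * (P⁻[fun ω' => ENNReal.ofReal (w ω')|m] ω).toReal -
        g ω * (P⁻[fun ω' => ENNReal.ofReal (-w ω')|m] ω).toReal := fun ω => by
    rw [realCondExp, mul_sub]
  simp_rw [h3]
  refine ⟨i1.sub i2, fun A hA => ?_⟩
  rw [integral_sub i1.integrableOn i2.integrableOn, e1 A hA, e2 A hA,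
    integral_eq_lintegral_pos_part_sub_lintegral_neg_part hgw.integrableOn]
  simp_rw [h1, h2]

/-- The conditional subgradient inequality. -/
theorem IsRiskFunctional.realCondExp_subgradient (hm : m ≤ m0) {r : ℝ} {R : (Ω → ℝ) → Ω → ℝ}
    (hR : IsRiskFunctional m P r R) (hr : 1 ≤ r) {x z f : Ω → ℝ} (hx : MemLpF m P r x)
    (hz : MemLpF m P r z) (hxm : Measurable x) (hzm : Measurable z)
    (hfm : Measurable f) (hf0 : ∀ ω, 0 ≤ f ω) (hfi : Integrable f P)
    (hf : ∀ u ∈ boundedMeasurable Ω,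
        -∫ ω, f ω * u ω ∂P ≤ ∫ ω, R (fun ω => x ω + u ω) ω - R x ω ∂P) :
    ∀ᵐ ω ∂P, realCondExp m P (fun ω => z ω * -f ω) ω - R z ω ≤
      realCondExp m P (fun ω => x ω * -f ω) ω - R x ω := by
  have hr0 : 0 ≤ r := by linarith
  set u : Ω → ℝ := fun ω => z ω - x ω with hudef
  have hum : Measurable u := hzm.sub hxm
  have huL : MemLpF m P r u := hz.sub hr hx
  have hxu : (fun ω => x ω + u ω) = z := by ext ω; simp [u]
  have hH : AEStronglyMeasurable[m] (fun ω => R (fun ω => x ω - |u ω|) ω - R x ω) P :=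
    (hR.meas _ (hx.sub hr (huL.abs hr0))).sub (hR.meas _ hx)
  set H := hH.mk _
  have hHm : Measurable[m] H := hH.stronglyMeasurable_mk.measurable
  have hD : AEStronglyMeasurable[m] (fun ω => R z ω - R x ω) P := (hR.meas _ hz).sub (hR.meas _ hx)
  set D := hD.mk _
  have hDm : Measurable[m] D := hD.stronglyMeasurable_mk.measurable
  have hzf : Measurable fun ω => z ω * -f ω := hzm.mul hfm.neg
  have hxf : Measurable fun ω => x ω * -f ω := hxm.mul hfm.neg
  have hHm' := (hHm.mono hm le_rfl).enorm
  -- One weight `g` is wanted that makes `z f`, `x f` and the majorant `H` integrable at once.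
  -- Testing with `1_A g` for all `A` in `m` then gives the inequality multiplied by `g`, and `g >
  -- 0` cancels.
  have hX : ∀ᵐ ω ∂P, P⁻[fun ω => ‖z ω * -f ω‖ₑ + (‖x ω * -f ω‖ₑ + ‖H ω‖ₑ)|m] ω < ∞ := by
    filter_upwards [condLExp_add_left (P := P) (mΩ := m) (fun ω => ‖x ω * -f ω‖ₑ + ‖H ω‖ₑ)
        hzf.enorm.aemeasurable,
      condLExp_add_left (P := P) (mΩ := m) (fun ω => ‖H ω‖ₑ) hxf.enorm.aemeasurable,
      hR.condLExp_mul_lt_top hm hr hx hfm hf0 hfi hf hzm hz,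
      hR.condLExp_mul_lt_top hm hr hx hfm hf0 hfi hf hxm hx] with ω h1 h2 h3 h4
    have e : ∀ v : Ω → ℝ, (fun ω => ‖v ω * -f ω‖ₑ) = fun ω => ‖f ω * v ω‖ₑ := fun v => by
      ext ω; rw [mul_neg, enorm_neg, mul_comm]
    refine lt_of_eq_of_lt h1 (ENNReal.add_lt_top.2 ⟨by rwa [e], lt_of_eq_of_lt h2
      (ENNReal.add_lt_top.2 ⟨by rwa [e], ?_⟩)⟩)
    rw [condLExp_eq_self (X := fun ω => ‖H ω‖ₑ) hm P (measurable_enorm.comp hHm)]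
    exact enorm_lt_top
  obtain ⟨g, hg, hg0, hg1, hgX⟩ := exists_weight hm
    (hzf.enorm.add (hxf.enorm.add hHm')).aemeasurable hX
  have hgm : Measurable g := hg.mono hm le_rfl
  have hint : ∀ k : Ω → ℝ, Measurable k →
      (∀ ω, ‖k ω‖ₑ ≤ ‖z ω * -f ω‖ₑ + (‖x ω * -f ω‖ₑ + ‖H ω‖ₑ)) →
      Integrable (fun ω => g ω * k ω) P := by
    refine fun k hk hle => ⟨(hgm.mul hk).aestronglyMeasurable,
      lt_of_le_of_lt (lintegral_mono fun ω => ?_) hgX⟩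
    rw [enorm_mul, Real.enorm_of_nonneg (hg0 ω).le]
    exact mul_le_mul_right (hle ω) _
  have iz := hint _ hzf fun ω => le_self_add
  have ix := hint _ hxf fun ω => le_self_add.trans le_add_self
  have iH := hint H (hHm.mono hm le_rfl) fun ω => le_add_self.trans le_add_self
  have iH' : Integrable (fun ω => g ω * (R (fun ω => x ω - |u ω|) ω - R x ω)) P :=
    iH.congr (hH.ae_eq_mk.mono fun ω h => by simp only [H]; rw [← h])
  have iD : Integrable (fun ω => g ω * D ω) P := by
    refine iH.mono (hgm.mul (hDm.mono hm le_rfl)).aestronglyMeasurable ?_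
    have h1 := hR.abs_sub_le hr hx huL (huL.abs hr0) (.of_forall fun ω => le_rfl)
    rw [hxu] at h1
    filter_upwards [hH.ae_eq_mk, hD.ae_eq_mk, h1] with ω h2 h3 h4
    rw [norm_mul, norm_mul]
    refine mul_le_mul_of_nonneg_left ?_ (norm_nonneg _)
    simp only [H, D]
    rw [← h2, ← h3]
    exact h4.trans (le_abs_self _)
  obtain ⟨jz, ez⟩ := setIntegral_weight_realCondExp hm hzf hg hg0 iz
  obtain ⟨jx, ex⟩ := setIntegral_weight_realCondExp hm hxf hg hg0 ix
  have key := ae_le_of_forall_setIntegral_le_of_le (P := P) hm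
    (F := fun ω => g ω * realCondExp m P (fun ω => z ω * -f ω) ω -
      g ω * realCondExp m P (fun ω => x ω * -f ω) ω) (G := fun ω => g ω * D ω)
    ((hg.mul (measurable_realCondExp _)).sub (hg.mul (measurable_realCondExp _))) (hg.mul hDm)
    (jz.sub jx) iD fun A hA => by
      obtain ⟨h1, h2, h3⟩ := indicator_one_weight (m := m) hA
      rw [integral_sub jz.integrableOn jx.integrableOn, ez A hA, ex A hA,
        ← integral_sub iz.integrableOn ix.integrableOn]
      have e1 : ∀ ω, f ω * (A.indicator (fun _ => (1 : ℝ)) ω * g ω * u ω) =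
          -(A.indicator (fun _ => (1 : ℝ)) ω * (g ω * (z ω * -f ω) - g ω * (x ω * -f ω))) :=
        fun ω => by simp only [u]; ring
      have h4 := hR.weighted_subgradient_of_memLpF hm hr hx hfm hf (h1.mul hg)
        (fun ω => mul_nonneg (h2 ω) (hg0 ω).le)
        (fun ω => mul_le_one₀ (h3 ω) (hg0 ω).le (hg1 ω)) hum huL ?_ ?_
      · simp only [Pi.mul_apply, hxu] at h4
        simp_rw [e1] at h4
        rw [integral_neg, neg_neg, integral_indicator_one_mul hm hA] at h4
        refine h4.trans (le_of_eq ?_)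
        simp_rw [mul_assoc]
        rw [integral_indicator_one_mul hm hA]
        refine integral_congr_ae (ae_restrict_of_ae ?_)
        filter_upwards [hD.ae_eq_mk] with ω h
        simp only [D]
        rw [← h]
      · simp only [Pi.mul_apply]
        simp_rw [e1]
        refine ((iz.sub ix).indicator (hm A hA)).neg.congr (.of_forall fun ω => ?_)
        by_cases h : ω ∈ A <;> simp [h]
      · simp only [Pi.mul_apply]
        refine (iH'.indicator (hm A hA)).congr (.of_forall fun ω => ?_)
        by_cases h : ω ∈ A <;> simp [h]
  filter_upwards [key, hD.ae_eq_mk] with ω h1 h2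
  rw [← mul_sub] at h1
  have h3 := le_of_mul_le_mul_left h1 (hg0 ω)
  simp only [D] at h3
  rw [← h2] at h3
  linarith

end RealCondExp

/-! ### Passage between classes and functions -/

section OfFun

variable {Ω : Type*} {m m0 : MeasurableSpace Ω} {P : Measure Ω}

open scoped Classical in
/-- The class of a function, with junk value `0` for functions that are not measurable. -/
noncomputable def ofFun (P : Measure Ω) (f : Ω → ℝ) : Ω →ₘ[P] ℝ :=
  if h : AEStronglyMeasurable f P then AEEqFun.mk f h else 0

theorem coeFn_ofFun {f : Ω → ℝ} (hf : AEStronglyMeasurable f P) : ofFun P f =ᵐ[P] f := by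
  rw [ofFun, dif_pos hf]
  exact AEEqFun.coeFn_mk f hf

theorem ofFun_coeFn (x : Ω →ₘ[P] ℝ) : ofFun P x = x :=
  AEEqFun.ext (coeFn_ofFun x.aestronglyMeasurable)

theorem ofFun_congr {f g : Ω → ℝ} (h : f =ᵐ[P] g) : ofFun P f = ofFun P g := by
  by_cases hf : AEStronglyMeasurable f P
  · exact AEEqFun.ext ((coeFn_ofFun hf).trans (h.trans (coeFn_ofFun (hf.congr h)).symm))
  · rw [ofFun, ofFun, dif_neg hf, dif_neg fun hg => hf (hg.congr h.symm)]

theorem ofFun_mem_L0 (hm : m ≤ m0) {η : Ω → ℝ} (hη : Measurable[m] η) : ofFun P η ∈ L0 m P :=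
  hη.stronglyMeasurable.aestronglyMeasurable.congr
    (coeFn_ofFun (hη.mono hm le_rfl).aestronglyMeasurable).symm

theorem memLpF_of_mem {p : ℝ≥0∞} (hp : p ≠ ∞) {x : Ω →ₘ[P] ℝ} (hx : x ∈ LpF m P p) :
    MemLpF m P p.toReal x :=
  ⟨x.aestronglyMeasurable, hx.2 hp⟩

theorem mem_LpF_of_memLpF {p : ℝ≥0∞} (hp : p ≠ ∞) {x : Ω →ₘ[P] ℝ} (hx : MemLpF m P p.toReal x) :
    x ∈ LpF m P p :=
  ⟨fun h => absurd h hp, fun _ => hx.2⟩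

theorem ofFun_mem_LpF {p : ℝ≥0∞} (hp : p ≠ ∞) {f : Ω → ℝ} (hf : MemLpF m P p.toReal f) :
    ofFun P f ∈ LpF m P p :=
  mem_LpF_of_memLpF hp (hf.congr ENNReal.toReal_nonneg (coeFn_ofFun hf.1))

theorem IsConditionalRiskMeasure.isRiskFunctional (hm : m ≤ m0) {p : ℝ≥0∞} (hp : p ≠ ∞)
    {ρ : (Ω →ₘ[P] ℝ) → (Ω →ₘ[P] ℝ)} (hρ : IsConditionalRiskMeasure m P (LpF m P p) ρ) :
    IsRiskFunctional m P p.toReal fun f => ρ (ofFun P f) where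
  meas f hf := hρ.mapsTo _ (ofFun_mem_LpF hp hf)
  convex η hη h0 h1 f g hf hg := by
    have hηm := (hη.mono hm le_rfl).aestronglyMeasurable (μ := P)
    have hη' := coeFn_ofFun hηm
    have h := hρ.convex (ofFun P η) (ofFun_mem_L0 hm hη) (by
        rw [← AEEqFun.coeFn_le]
        filter_upwards [hη', AEEqFun.coeFn_zero (μ := P) (β := ℝ)] with ω e1 e2
        rw [e1, e2]; exact h0 ω) (by
        rw [← AEEqFun.coeFn_le]
        filter_upwards [hη', AEEqFun.coeFn_one (μ := P) (β := ℝ)] with ω e1 e2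
        rw [e1, e2]; exact h1 ω)
      _ (ofFun_mem_LpF hp hf) _ (ofFun_mem_LpF hp hg)
    have hev : ∀ a b : Ω →ₘ[P] ℝ, ∀ᵐ ω ∂P,
        (ofFun P η * a + (1 - ofFun P η) * b : Ω →ₘ[P] ℝ) ω = η ω * a ω + (1 - η ω) * b ω := by
      intro a b
      filter_upwards [AEEqFun.coeFn_add (ofFun P η * a) ((1 - ofFun P η) * b),
        AEEqFun.coeFn_mul (ofFun P η) a, AEEqFun.coeFn_mul (1 - ofFun P η) b,
        AEEqFun.coeFn_sub (1 : Ω →ₘ[P] ℝ) (ofFun P η), hη',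
        AEEqFun.coeFn_one (μ := P) (β := ℝ)] with ω e1 e2 e3 e4 e5 e6
      rw [e1, Pi.add_apply, e2, e3, Pi.mul_apply, Pi.mul_apply, e4, Pi.sub_apply, e5, e6,
        Pi.one_apply]
    have he : ofFun P η * ofFun P f + (1 - ofFun P η) * ofFun P g =
        ofFun P fun ω => η ω * f ω + (1 - η ω) * g ω := by
      refine AEEqFun.ext ?_
      filter_upwards [hev (ofFun P f) (ofFun P g), coeFn_ofFun hf.1, coeFn_ofFun hg.1,
        coeFn_ofFun ((hηm.mul hf.1).add ((aestronglyMeasurable_const.sub hηm).mul hg.1))]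
        with ω e1 e2 e3 e4
      rw [e1, e2, e3]
      exact e4.symm
    rw [he, ← AEEqFun.coeFn_le] at h
    filter_upwards [h, hev (ρ (ofFun P f)) (ρ (ofFun P g))] with ω e1 e2
    exact e1.trans e2.le
  antitone f g hf hg h := by
    refine AEEqFun.coeFn_le.2 (hρ.antitone _ (ofFun_mem_LpF hp hf) _ (ofFun_mem_LpF hp hg) ?_)
    rw [← AEEqFun.coeFn_le]
    filter_upwards [h, coeFn_ofFun hf.1, coeFn_ofFun hg.1] with ω e1 e2 e3
    rwa [e2, e3]
  cash_invariant f η hf hη := by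
    have hηm := (hη.mono hm le_rfl).aestronglyMeasurable (μ := P)
    have h := hρ.cash_invariant _ (ofFun_mem_LpF hp hf) (ofFun P η) (ofFun_mem_L0 hm hη)
    have he : ofFun P f + ofFun P η = ofFun P fun ω => f ω + η ω := by
      refine AEEqFun.ext ?_
      filter_upwards [AEEqFun.coeFn_add (ofFun P f) (ofFun P η), coeFn_ofFun hf.1,
        coeFn_ofFun hηm, coeFn_ofFun (hf.1.add hηm)] with ω e1 e2 e3 e4
      rw [e1, Pi.add_apply, e2, e3]
      exact e4.symm
    rw [he] at h
    rw [h]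
    filter_upwards [AEEqFun.coeFn_sub (ρ (ofFun P f)) (ofFun P η), coeFn_ofFun hηm] with ω e1 e2
    rw [e1, Pi.sub_apply, e2]
  congr f g h := by rw [ofFun_congr h]

end OfFun

/-! ### Membership in the conjugate module -/

section Conjugate

variable {Ω : Type*} {m m0 : MeasurableSpace Ω} {P : Measure Ω} [IsProbabilityMeasure P]

/-- A function whose products with the elements of `L^p_𝓕(𝓔)` have finite conditional expectation
belongs to `L^q_𝓕(𝓔)`, for the conjugate exponent `q`. -/
theorem ofFun_mem_LpF_conjugate (hm : m ≤ m0) {p q : ℝ≥0∞} (hp : 1 ≤ p) (hp' : p < ∞)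
    (hpq : ENNReal.HolderConjugate p q) {f : Ω → ℝ} (hf : Measurable f)
    (h : ∀ u, Measurable u → MemLpF m P p.toReal u →
      ∀ᵐ ω ∂P, P⁻[fun ω => ‖f ω * u ω‖ₑ|m] ω < ∞) : ofFun P f ∈ LpF m P q := by
  have h' : ∀ U : Ω → ℝ≥0∞, Measurable U → (∀ᵐ ω ∂P, P⁻[fun ω => U ω ^ p.toReal|m] ω < ∞) →
      ∀ᵐ ω ∂P, P⁻[fun ω => ‖f ω‖ₑ * U ω|m] ω < ∞ := by
    intro U hU hUfin
    have hp0 : 0 < p.toReal := ENNReal.toReal_pos (by positivity) hp'.ne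
    -- The Landau lemmas test with values in `[0, ∞]`, the hypothesis with real functions;
    -- finiteness of the conditional moment makes `U` finite almost surely.
    have hUt : ∀ᵐ ω ∂P, ‖(U ω).toReal‖ₑ = U ω := by
      filter_upwards [ae_lt_top_of_condLExp_lt_top hm (hU.pow_const _).aemeasurable hUfin] with ω hω
      have : U ω ≠ ∞ := by
        intro e
        rw [e, ENNReal.top_rpow_of_pos hp0] at hω
        exact lt_irrefl _ hω
      rw [Real.enorm_of_nonneg ENNReal.toReal_nonneg, ENNReal.ofReal_toReal this]
    refine condLExp_lt_top_of_le ?_ (h (fun ω => (U ω).toReal) hU.ennreal_toReal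
      ⟨hU.ennreal_toReal.aestronglyMeasurable, condLExp_lt_top_of_le ?_ hUfin⟩)
    · filter_upwards [hUt] with ω hω
      rw [enorm_mul, hω]
    · filter_upwards [hUt] with ω hω
      rw [hω]
  have hfc := coeFn_ofFun (P := P) hf.aestronglyMeasurable
  rcases hp.eq_or_lt with rfl | hp1
  · have hq : q = ∞ := by
      have := hpq.inv_add_inv_eq_inv
      simpa using this
    subst hq
    refine ⟨fun _ => ?_, fun h => absurd rfl h⟩
    simp only [ENNReal.toReal_one, ENNReal.rpow_one] at h'
    obtain ⟨η, hη, hle⟩ := exists_le_of_dual_one hm hf.enorm (fun ω => enorm_ne_top) h'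
    have hηr : Measurable[m] fun ω => (η ω).toReal := hη.ennreal_toReal
    refine ⟨ofFun P fun ω => (η ω).toReal, ofFun_mem_L0 hm hηr, ?_⟩
    rw [← AEEqFun.coeFn_le]
    filter_upwards [hfc, hle, AEEqFun.coeFn_abs (ofFun P f),
      coeFn_ofFun (P := P) (hηr.mono hm le_rfl).aestronglyMeasurable] with ω e1 e2 e3 e4
    rw [e3, e1, e4]
    simpa using ENNReal.toReal_mono e2.1.ne e2.2
  · have hp1' : 1 < p.toReal := by
      rw [← ENNReal.toReal_one]
      exact (ENNReal.toReal_lt_toReal ENNReal.one_ne_top hp'.ne).2 hp1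
    have hc : p.toReal.HolderConjugate q.toReal := ENNReal.HolderConjugate.toReal hp1'
    have hq : q ≠ ∞ := fun e => by
      have := hc.symm.pos
      simp [e] at this
    refine ofFun_mem_LpF hq ⟨hf.aestronglyMeasurable, ?_⟩
    exact condLExp_rpow_lt_top_of_dual hm hp1' hc.symm.lt.le hc.symm.sub_one_mul_conj hf.enorm
      (fun ω => enorm_ne_top) h'

end Conjugate

end CondRisk

/-! ### Lebesgue property and attained dual representation -/

theorem mainTheorem5 {Ω : Type*} {m m0 : MeasurableSpace Ω} (hm : m ≤ m0) (P : @Measure Ω m0)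
    [IsProbabilityMeasure P] (p q : ℝ≥0∞) (hp : 1 ≤ p) (hp' : p < ∞)
    (hpq : ENNReal.HolderConjugate p q) (ρ : (Ω →ₘ[P] ℝ) → (Ω →ₘ[P] ℝ))
    (hρ : CondRisk.IsConditionalRiskMeasure m P (CondRisk.LpF m P p) ρ) :
    CondRisk.HasLebesgueProperty P (CondRisk.LpF m P p) ρ ∧
    ∀ x ∈ CondRisk.LpF m P p, ∃ y : CondRisk.koetheDual m P (CondRisk.LpF m P p),
      (y : Ω →ₘ[P] ℝ) ∈ CondRisk.LpF m P q ∧ (y : Ω →ₘ[P] ℝ) ≤ 0 ∧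
      (∀ᵐ ω ∂P, CondRisk.extCondExp m P y ω = -1) ∧
      ∀ᵐ ω ∂P, (ρ x ω : EReal) =
        CondRisk.extCondExp m P (x * y) ω - CondRisk.fenchel m P (CondRisk.LpF m P p) ρ y ω := by
  open CondRisk in
  have hR := hρ.isRiskFunctional hm hp'.ne
  have hr : 1 ≤ p.toReal := by
    rw [← ENNReal.toReal_one]
    exact ENNReal.toReal_mono hp'.ne hp
  refine ⟨fun u x y hu hx hy huy hlim => ?_, fun x hx => ?_⟩
  · have h := hR.tendsto hm hr (fun n => memLpF_of_mem hp'.ne (hu n)) (memLpF_of_mem hp'.ne hx)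
      (memLpF_of_mem hp'.ne hy) (fun n => by
        filter_upwards [AEEqFun.coeFn_le.2 (huy n), AEEqFun.coeFn_abs (u n)] with ω e1 e2
        rwa [← e2]) hlim
    simpa only [ofFun_coeFn] using h
  · have hxL := memLpF_of_mem hp'.ne hx
    obtain ⟨f, hfm, hf0, hfi, hf⟩ := hR.exists_integral_subgradient hm hr hxL
    have hy := coeFn_ofFun (P := P) hfm.neg.aestronglyMeasurable
    have hfin : ∀ z ∈ LpF m P p, ∀ᵐ ω ∂P, P⁻[fun ω => ‖z ω * -f ω‖ₑ|m] ω < ∞ := by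
      intro z hz
      have := hR.condLExp_mul_lt_top hm hr hxL hfm hf0 hfi hf z.measurable
        (memLpF_of_mem hp'.ne hz)
      have e : (fun ω => ‖z ω * -f ω‖ₑ) = fun ω => ‖f ω * z ω‖ₑ := by
        ext ω
        rw [mul_neg, enorm_neg, mul_comm]
      rwa [e]
    have hzy : ∀ z : Ω →ₘ[P] ℝ, (z * ofFun P (-f) : Ω →ₘ[P] ℝ) =ᵐ[P] fun ω => z ω * -f ω := by
      intro z
      filter_upwards [AEEqFun.coeFn_mul z (ofFun P (-f)), hy] with ω e1 e2
      rw [e1, Pi.mul_apply, e2, Pi.neg_apply]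
    have hk : ofFun P (-f) ∈ koetheDual m P (LpF m P p) := by
      intro z hz
      refine mem_LpF_of_memLpF ENNReal.one_ne_top ⟨AEEqFun.aestronglyMeasurable _, ?_⟩
      simp only [ENNReal.toReal_one, ENNReal.rpow_one]
      refine condLExp_lt_top_of_le ?_ (hfin z hz)
      filter_upwards [hzy z] with ω e
      rw [e]
    have hsub : ∀ z ∈ LpF m P p, ∀ᵐ ω ∂P,
        realCondExp m P (fun ω => z ω * -f ω) ω - ρ z ω ≤
          realCondExp m P (fun ω => x ω * -f ω) ω - ρ x ω := by
      intro z hz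
      have := hR.realCondExp_subgradient hm hr hxL (memLpF_of_mem hp'.ne hz) x.measurable
        z.measurable hfm hf0 hfi hf
      simpa only [ofFun_coeFn] using this
    have hext : ∀ z ∈ LpF m P p, ∀ᵐ ω ∂P, extCondExp m P (z * ofFun P (-f)) ω =
        (realCondExp m P (fun ω => z ω * -f ω) ω : EReal) := fun z hz =>
      extCondExp_eq_realCondExp (hzy z) (hfin z hz)
    refine ⟨⟨ofFun P (-f), hk⟩, ?_, ?_, ?_, ?_⟩
    · refine ofFun_mem_LpF_conjugate hm hp hp' hpq hfm.neg fun u hu huL => ?_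
      have := hR.condLExp_mul_lt_top hm hr hxL hfm hf0 hfi hf hu huL
      simpa only [Pi.neg_apply, neg_mul, enorm_neg] using this
    · rw [← AEEqFun.coeFn_le]
      filter_upwards [hy, AEEqFun.coeFn_zero (μ := P) (β := ℝ)] with ω e1 e2
      rw [e1, e2]
      simpa using hf0 ω
    · have h1 : (fun ω => ENNReal.ofReal (ofFun P (-f) ω)) =ᵐ[P] 0 := by
        filter_upwards [hy] with ω e
        rw [e]
        simpa using hf0 ω
      have h2 : (fun ω => ENNReal.ofReal (-ofFun P (-f) ω)) =ᵐ[P] fun ω => ENNReal.ofReal (f ω) := by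
        filter_upwards [hy] with ω e
        rw [e, Pi.neg_apply, neg_neg]
      filter_upwards [condLExp_congr_ae (mΩ := m) h1, condLExp_congr_ae (mΩ := m) h2,
        hR.condLExp_density hm hr hxL hf0 hfi hf] with ω e1 e2 e3
      rw [extCondExp, e1, e2, e3]
      simp
    -- `F` is the member of the family at `x`; the subgradient inequality makes it the greatest, so
    -- `ρ^#(y)` is real-valued and the final subtraction cancels.
    · let F : Ω → EReal := fun ω =>
        ((realCondExp m P (fun ω => x ω * -f ω) ω - ρ x ω : ℝ) : EReal)
      have hF : AEStronglyMeasurable F P :=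
        (measurable_coe_real_ereal.comp (((measurable_realCondExp _).mono hm le_rfl).sub
          (ρ x).measurable)).aestronglyMeasurable
      have hFc := AEEqFun.coeFn_mk F hF
      have hlub : IsLUB {z : Ω →ₘ[P] EReal | ∃ x ∈ LpF m P p,
          z =ᵐ[P] fun ω => extCondExp m P (x * ofFun P (-f)) ω - (ρ x ω : EReal)}
          (AEEqFun.mk F hF) := by
        refine IsGreatest.isLUB ⟨⟨x, hx, ?_⟩, ?_⟩
        · filter_upwards [hFc, hext x hx] with ω e1 e2
          rw [e1, e2, ← EReal.coe_sub]
        · rintro w ⟨z, hz, hw⟩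
          rw [← AEEqFun.coeFn_le]
          filter_upwards [hw, hFc, hext z hz, hsub z hz] with ω e1 e2 e3 e4
          rw [e1, e2, e3, ← EReal.coe_sub]
          exact EReal.coe_le_coe_iff.2 e4
      have hfen : fenchel m P (LpF m P p) ρ ⟨ofFun P (-f), hk⟩ = AEEqFun.mk F hF :=
        (isLUB_esssup P _).unique hlub
      rw [hfen]
      filter_upwards [hFc, hext x hx] with ω e1 e2
      rw [e1, e2, ← EReal.coe_sub, sub_sub_cancel]
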